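/- Theorem 3.1. Partitions are identified with their diagrams. For partitions $\mu\subseteq\lambda$ let $[\lambda/\mu]=\sum_\nu c(\lambda;\mu,\nu)[\nu]$ be the skew character, where the Littlewood–Richardson coefficient $c(\lambda;\mu,\nu)$ is the number of semistandard tableaux of shape $\lambda/\mu$ and content $\nu$ whose reverse row word (rows from top to bottom, each read from right to left) is a lattice word; $[\nu]\in[\lambda/\mu]$ means $c(\lambda;\mu,\nu)\neq 0$. For a partition $\nu$ let $hl(\nu)=(hl_1(\nu),hl_2(\nu),\dots)$, where $hl_i(\nu)$ is the hook length of the box $(i,i)$ of $\nu$ (and $0$ if $(i,i)\notin\nu$), and let $d(\nu)$ be the side length of the largest square contained in $\nu$. For a skew diagram $\mathcal A=\lambda/\mu$ let $hl(\mathcal A)$ be the lexicographically greatest of the sequences $hl(\nu)$ with $[\nu]\in[\mathcal A]$. Let $nw_1(\mathcal A)$ be the set of boxes $(i,j)$ of $\mathcal A$ along its northwest border, i.e. with $(i-1,j-1)\notin\mathcal A$, let $nw_{i+1}(\mathcal A)$ be the set obtained in the same way after the removal of $nw_1(\mathcal A),\dots,nw_i(\mathcal A)$, and let $\pi_{nw}(\mathcal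 A)=(|nw_1(\mathcal A)|,|nw_2(\mathcal A)|,\dots)$. Let $\mathcal A=\lambda/\mu$ be a skew diagram which decomposes into two (ordinary, that is non-skew) partitions $\alpha$ and $\beta$: it is the union of a translate of $\alpha$ and a translate of $\beta$, and no box of the one is in the same row or column as a box of the other. Then $$hl(\mathcal A)=hl(\alpha)+hl(\beta)=\pi_{nw}(\mathcal A),$$ where the sum is taken part by part. Furthermore, there are exactly $2^{\min(d(\alpha),d(\beta))}$ partitions $\nu$ with $[\nu]\in[\mathcal A]$ and $hl(\nu)=hl(\mathcal A)$, and for each of them $[\nu]$ has multiplicity $c(\lambda;\mu,\nu)=1$ in $[\mathcal A]$. -/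

import Mathlib

/-!
Partitions are Mathlib's `YoungDiagram`s.  A box is a pair `(i, j)` (row, column) in matrix-style
coordinates, both counted from `0`; `rowLen i` is the number of boxes in row `i` and `colLen j` the
number of boxes in column `j`.
-/

namespace PrincipalHook

/-- The boxes of the skew diagram `lam / mu`. -/
def skewDiagram (lam mu : YoungDiagram) : Finset (ℕ × ℕ) := lam.cells \ mu.cells

/-- The number of entries equal to `k` that the filling `T` has in the set of boxes `S`. -/
def countEntry (S : Finset (ℕ × ℕ)) (T : ℕ → ℕ → ℕ) (k : ℕ) : ℕ :=
  (S.filter (fun c => T c.1 c.2 = k)).card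

/-- The boxes of `S` that are read no later than the box `c`, when `S` is read row by row from top
to bottom and each row from right to left. -/
def readUpTo (S : Finset (ℕ × ℕ)) (c : ℕ × ℕ) : Finset (ℕ × ℕ) :=
  S.filter (fun d => d.1 < c.1 ∨ (d.1 = c.1 ∧ c.2 ≤ d.2))

/-- `T` is a Littlewood-Richardson tableau of shape `S` (the boxes of a skew diagram) and
content `nu`: a semistandard filling of `S` by positive integers in which the entry `k + 1` occurs
`nu.rowLen k` times, and whose reverse row word is a lattice word.  The filling is a function on all
of `ℕ × ℕ` with the value `0` outside `S`, so that different functions are different tableaux. -/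
structure IsLRTableau (S : Finset (ℕ × ℕ)) (nu : YoungDiagram) (T : ℕ → ℕ → ℕ) : Prop where
  outside : ∀ i j, (i, j) ∉ S → T i j = 0
  pos : ∀ i j, (i, j) ∈ S → 1 ≤ T i j
  row_weak : ∀ i j, (i, j) ∈ S → (i, j + 1) ∈ S → T i j ≤ T i (j + 1)
  col_strict : ∀ i j, (i, j) ∈ S → (i + 1, j) ∈ S → T i j < T (i + 1) j
  content : ∀ k, countEntry S T (k + 1) = nu.rowLen k
  /-- The nonempty prefixes of the reverse row word are the words of `readUpTo S c` for `c ∈ S`. -/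
  lattice : ∀ c ∈ S, ∀ k, 1 ≤ k →
    countEntry (readUpTo S c) T (k + 1) ≤ countEntry (readUpTo S c) T k

/-- The Littlewood-Richardson coefficient `c(lam; mu, nu)`: the number of LR tableaux of shape
`lam / mu` and content `nu`.  This is the multiplicity of the irreducible character `[nu]` in the
skew character `[lam / mu] = ∑ c(lam; mu, nu) [nu]`. -/
noncomputable def lrCoeff (lam mu nu : YoungDiagram) : ℕ :=
  {T : ℕ → ℕ → ℕ | IsLRTableau (skewDiagram lam mu) nu T}.ncard

/-- There are only finitely many LR tableaux of given shape and content, so `Set.ncard` really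
counts them. -/
theorem finite_isLRTableau (S : Finset (ℕ × ℕ)) (nu : YoungDiagram) :
    {T : ℕ → ℕ → ℕ | IsLRTableau S nu T}.Finite := by
  have hfin : (Set.pi Set.univ (fun _ : S => Set.Iic (nu.colLen 0))).Finite :=
    Set.Finite.pi' (fun _ => Set.finite_Iic _) |>.subset (fun f hf i => hf i trivial)
  refine Set.Finite.of_injOn (f := fun (T : ℕ → ℕ → ℕ) (c : S) => T c.1.1 c.1.2) ?_ ?_ hfin
  · rintro T hT ⟨⟨i, j⟩, hc⟩ -
    have hp := hT.pos i j hc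
    obtain ⟨k, hk⟩ : ∃ k, T i j = k + 1 := ⟨T i j - 1, by omega⟩
    have h1 : 0 < countEntry S T (k + 1) :=
      Finset.card_pos.mpr ⟨(i, j), Finset.mem_filter.mpr ⟨hc, hk⟩⟩
    rw [hT.content k, ← YoungDiagram.mem_iff_lt_rowLen, YoungDiagram.mem_iff_lt_colLen] at h1
    show T i j ≤ nu.colLen 0
    omega
  · intro T hT U hU h
    funext i j
    by_cases hc : (i, j) ∈ S
    · exact congrFun h ⟨(i, j), hc⟩
    · rw [hT.outside i j hc, hU.outside i j hc]

/-- `[nu] ∈ [lam / mu]`: the irreducible character `[nu]` appears in the skew character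
`[lam / mu]`. -/
def Appears (lam mu nu : YoungDiagram) : Prop := lrCoeff lam mu nu ≠ 0

/-- The translate of (the diagram of) the partition `alpha` whose top left box would be `p`. -/
def translate (alpha : YoungDiagram) (p : ℕ × ℕ) : Finset (ℕ × ℕ) :=
  alpha.cells.map (addRightEmbedding p)

/-- The set of boxes `S` decomposes into the partitions `alpha` and `beta`: it is the union of a
translate of `alpha` and a translate of `beta`, and no box of the one is in the same row or in the
same column as a box of the other. -/
def DecomposesInto (S : Finset (ℕ × ℕ)) (alpha beta : YoungDiagram) : Prop :=
  ∃ p q : ℕ × ℕ, S = translate alpha p ∪ translate beta q ∧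
    ∀ x ∈ translate alpha p, ∀ y ∈ translate beta q, x.1 ≠ y.1 ∧ x.2 ≠ y.2

/-- The number of boxes of `lam` to the right of the box `(i, j)` of `lam`, in the same row. -/
def arm (lam : YoungDiagram) (i j : ℕ) : ℕ := lam.rowLen i - (j + 1)

/-- The number of boxes of `lam` below the box `(i, j)` of `lam`, in the same column. -/
def leg (lam : YoungDiagram) (i j : ℕ) : ℕ := lam.colLen j - (i + 1)

/-- The hook length of the box `(i, j)` of `lam`. -/
def hookLength (lam : YoungDiagram) (i j : ℕ) : ℕ := arm lam i j + leg lam i j + 1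

/-- The principal hook length partition of `lam`, as the sequence of its parts: the hook lengths of
the diagonal boxes `(i, i)` of `lam`, followed by zeros. -/
def hl (lam : YoungDiagram) (i : ℕ) : ℕ := if (i, i) ∈ lam then hookLength lam i i else 0

/-- `h` is the hook length partition of the skew diagram `lam / mu`: the lexicographically greatest
among the hook length partitions `hl nu` of the `nu` with `[nu] ∈ [lam / mu]`. -/
def IsSkewHl (lam mu : YoungDiagram) (h : ℕ → ℕ) : Prop :=
  IsGreatest {x : Lex (ℕ → ℕ) | ∃ nu : YoungDiagram, Appears lam mu nu ∧ x = toLex (hl nu)}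
    (toLex h)

/-- The Durfee size of `lam`: the side of the largest square contained in `lam` (such a side is at
most the number of boxes of `lam`). -/
def durfee (lam : YoungDiagram) : ℕ :=
  Nat.findGreatest (fun d => ∀ i < d, ∀ j < d, (i, j) ∈ lam) lam.card

/-- The first northwest ribbon of a skew diagram: the boxes along its northwest border, that is
those whose diagonal neighbour to the northwest is not a box of the diagram.  In a connected
diagram this is the ribbon that leads from the lowest leftmost box along the northwest border to the
top right box.  Diagonally adjacent boxes of a skew diagram are connected through the diagram, so
for a disconnected diagram this is the union of the first northwest ribbons of the parts. -/
def nwFirst (S : Finset (ℕ × ℕ)) : Finset (ℕ × ℕ) :=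
  S.filter (fun c => ∀ d ∈ S, d + (1, 1) ≠ c)

/-- What is left of a skew diagram after its first `i` northwest ribbons have been removed, one
after the other. -/
def nwRest (S : Finset (ℕ × ℕ)) : ℕ → Finset (ℕ × ℕ)
  | 0 => S
  | i + 1 => nwRest S i \ nwFirst (nwRest S i)

/-- The northwest ribbons of a skew diagram, numbered from `0`. -/
def nwRibbon (S : Finset (ℕ × ℕ)) (i : ℕ) : Finset (ℕ × ℕ) := nwFirst (nwRest S i)

/-- The northwest ribbon length partition, as the sequence of its parts. -/
def piNW (S : Finset (ℕ × ℕ)) (i : ℕ) : ℕ := (nwRibbon S i).card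

end PrincipalHook

/-! Let `A` be the component in the upper rows and `D` the lower one. The reading word runs through
`A` first, and the lattice property forces row `i` of `A` to be constant. A Littlewood–Richardson
tableau is thus a semistandard filling of `D` whose entries say to which rows of `A` boxes are
added, each row of `D` adding a horizontal strip (`bijOn_localFilling`). So the coefficient of `nu`
counts the dominant fillings `U` of `D` with resulting shape `nu`.

The rest is induction on diagonal layers: the first row and column of `A`, `D` and `nu` are removed
together. The first row of `nu` gains one box per entry `0`, at most the length of row `0` of `D`;
each row of `D` opens at most one new row of `nu`. Row `0` of `D` cannot do both fully: either it
consists of zeros and opens no new row, or it ends in a nonzero entry and the first row of `nu`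
falls short. One box is lost either way, so the first hook of `nu` is at most the sum of the first
hooks of `A` and `D` (`hook_le_and_extremal`).

Equality allows two cases, encoded by `s`: `s = 1` (full first row, first column one short) and `s =
0` (the reverse). In both, each row of `D` from row `s` on must open a new row with its last entry.
Deleting row `0` and these row ends leaves a dominant filling for the cores, with shape `core nu`
(`exists_extends`). Conversely, each filling for the cores extends for each `s`
(`exists_extension`), and uniquely so.

Since the tail of `hl` is `hl` of the core, this gives the lexicographic maximum (`toLex_hl_le`).
Each layer doubles the number of extremal shapes until one diagram is exhausted, whence the exponent
`min` of the Durfee sizes (`encard_extremalShapes`). As `nu` determines `s`, multiplicities are one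
(`eq_of_hl_eq`). The northwest ribbons of a partition are its principal hooks, and those of the two
components do not interact (`piNW_of_decomposition`). -/

namespace PrincipalHook

/-! ### Young diagrams without their first row and column -/

/-- The Young diagram `D` without its first row and its first column. -/
def core (D : YoungDiagram) : YoungDiagram where
  cells := (D.cells.filter (fun c => 1 ≤ c.1 ∧ 1 ≤ c.2)).image (fun c => (c.1 - 1, c.2 - 1))
  isLowerSet := by
    rintro ⟨i, j⟩ ⟨i', j'⟩ hle h
    simp only [Finset.coe_image, Finset.coe_filter, Set.mem_image, Set.mem_ofPred_eq,
      YoungDiagram.mem_cells, Prod.mk.injEq, Prod.exists] at h ⊢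
    obtain ⟨x, y, ⟨hD, hx, hy⟩, rfl, rfl⟩ := h
    obtain ⟨h1, h2⟩ := Prod.mk_le_mk.mp hle
    exact ⟨i' + 1, j' + 1, ⟨D.up_left_mem (by omega) (by omega) hD, by omega, by omega⟩, rfl, rfl⟩

theorem mem_core {D : YoungDiagram} {i j : ℕ} : (i, j) ∈ core D ↔ (i + 1, j + 1) ∈ D := by
  rw [← YoungDiagram.mem_cells, core]
  simp only [Finset.mem_image, Finset.mem_filter, YoungDiagram.mem_cells, Prod.mk.injEq,
    Prod.exists]
  constructor
  · rintro ⟨x, y, ⟨hD, hx, hy⟩, rfl, rfl⟩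
    rwa [Nat.sub_add_cancel hx, Nat.sub_add_cancel hy]
  · exact fun h => ⟨i + 1, j + 1, ⟨h, by omega, by omega⟩, rfl, rfl⟩

theorem rowLen_core (D : YoungDiagram) (i : ℕ) : (core D).rowLen i = D.rowLen (i + 1) - 1 :=
  eq_of_forall_lt_iff fun j => by
    rw [← YoungDiagram.mem_iff_lt_rowLen, mem_core, YoungDiagram.mem_iff_lt_rowLen]
    omega

theorem colLen_core (D : YoungDiagram) (j : ℕ) : (core D).colLen j = D.colLen (j + 1) - 1 :=
  eq_of_forall_lt_iff fun i => by
    rw [← YoungDiagram.mem_iff_lt_colLen, mem_core, YoungDiagram.mem_iff_lt_colLen]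
    omega

theorem colLen_core_zero_le (D : YoungDiagram) : (core D).colLen 0 ≤ D.colLen 0 - 1 := by
  rw [colLen_core]
  exact Nat.sub_le_sub_right (D.colLen_anti 0 1 zero_le_one) 1

theorem rowLen_pos_iff {D : YoungDiagram} {i : ℕ} : 0 < D.rowLen i ↔ i < D.colLen 0 := by
  rw [← YoungDiagram.mem_iff_lt_rowLen, YoungDiagram.mem_iff_lt_colLen]

theorem rowLen_eq_zero {D : YoungDiagram} {i : ℕ} (h : D.colLen 0 ≤ i) : D.rowLen i = 0 := by
  have := rowLen_pos_iff (D := D) (i := i)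
  omega

theorem rowLen_succ_le (D : YoungDiagram) (i : ℕ) : D.rowLen (i + 1) ≤ D.rowLen i :=
  D.rowLen_anti _ _ i.le_succ

theorem eq_bot_of_zero_notMem {D : YoungDiagram} (h : (0, 0) ∉ D) : D = ⊥ := by
  ext ⟨i, j⟩
  simp only [YoungDiagram.mem_cells, YoungDiagram.notMem_bot, iff_false]
  exact fun h' => h (D.up_left_mem i.zero_le j.zero_le h')

theorem rowLen_bot (i : ℕ) : (⊥ : YoungDiagram).rowLen i = 0 := by
  by_contra h
  exact YoungDiagram.notMem_bot (i, 0) (YoungDiagram.mem_iff_lt_rowLen.mpr (Nat.pos_of_ne_zero h))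

theorem colLen_bot (j : ℕ) : (⊥ : YoungDiagram).colLen j = 0 := by
  by_contra h
  exact YoungDiagram.notMem_bot (0, j) (YoungDiagram.mem_iff_lt_colLen.mpr (Nat.pos_of_ne_zero h))

theorem ext_rowLen {D E : YoungDiagram} (h : ∀ i, D.rowLen i = E.rowLen i) : D = E := by
  ext ⟨i, j⟩
  rw [YoungDiagram.mem_cells, YoungDiagram.mem_cells, YoungDiagram.mem_iff_lt_rowLen, h,
    YoungDiagram.mem_iff_lt_rowLen]

theorem ext_core {D E : YoungDiagram} (hrow : D.rowLen 0 = E.rowLen 0)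
    (hcol : D.colLen 0 = E.colLen 0) (hcore : core D = core E) : D = E := by
  ext ⟨i, j⟩
  rw [YoungDiagram.mem_cells, YoungDiagram.mem_cells]
  rcases i with _ | i
  · rw [YoungDiagram.mem_iff_lt_rowLen, YoungDiagram.mem_iff_lt_rowLen, hrow]
  rcases j with _ | j
  · rw [YoungDiagram.mem_iff_lt_colLen, YoungDiagram.mem_iff_lt_colLen, hcol]
  rw [← mem_core, ← mem_core, hcore]

theorem exists_rowLen_eq {f : ℕ → ℕ} (hf : Antitone f) {n : ℕ} (hn : f n = 0) :
    ∃ D : YoungDiagram, ∀ i, D.rowLen i = f i := by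
  have hlt : ∀ {i j}, j < f i → i < n := fun {i j} h => by
    by_contra hi
    have := hf (not_lt.mp hi)
    omega
  let D : YoungDiagram :=
    { cells := (Finset.range n ×ˢ Finset.range (f 0)).filter (fun c => c.2 < f c.1)
      isLowerSet := by
        rintro ⟨i, j⟩ ⟨i', j'⟩ hle h
        obtain ⟨h1, h2⟩ := Prod.mk_le_mk.mp hle
        simp only [Finset.coe_filter, Finset.mem_product, Finset.mem_range, Set.mem_ofPred_eq]
          at h ⊢
        have := hf h1
        have := hf i'.zero_le
        omega }
  have hD : ∀ i j, (i, j) ∈ D ↔ j < f i := fun i j => by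
    rw [← YoungDiagram.mem_cells]
    simp only [D, Finset.mem_filter, Finset.mem_product, Finset.mem_range]
    have := hf i.zero_le
    exact ⟨fun h => h.2, fun h => ⟨⟨hlt h, by omega⟩, h⟩⟩
  exact ⟨D, fun i => eq_of_forall_lt_iff fun j => by
    rw [← YoungDiagram.mem_iff_lt_rowLen, hD]⟩

/-- Induction on a pair of Young diagrams that removes the first row and the first column of
both. -/
theorem core_induction {P : YoungDiagram → YoungDiagram → Prop} (bot_left : ∀ D, P ⊥ D)
    (bot_right : ∀ D, P D ⊥)
    (step : ∀ D E, (0, 0) ∈ D → (0, 0) ∈ E → P (core D) (core E) → P D E) (D E) : P D E := by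
  induction h : D.colLen 0 using Nat.strong_induction_on generalizing D E with
  | _ n ih =>
    by_cases hD : (0, 0) ∈ D
    · by_cases hE : (0, 0) ∈ E
      · refine step D E hD hE (ih _ ?_ _ _ rfl)
        have := colLen_core_zero_le D
        have := YoungDiagram.mem_iff_lt_colLen.mp hD
        omega
      · exact eq_bot_of_zero_notMem hE ▸ bot_right D
    · exact eq_bot_of_zero_notMem hD ▸ bot_left E

/-! ### Principal hook lengths and Durfee sizes -/

theorem hl_bot : hl ⊥ = 0 := by
  funext i
  simp [hl, YoungDiagram.notMem_bot]

/-- The arm and leg of `(i + 1, i + 1)` lie inside the core, so removing a layer only shifts the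
sequence of principal hooks. This makes the lexicographic comparison inductive. -/
theorem hl_core (D : YoungDiagram) (i : ℕ) : hl (core D) i = hl D (i + 1) := by
  simp only [hl, mem_core, hookLength, arm, leg, rowLen_core, colLen_core]
  split_ifs with h
  · have := YoungDiagram.mem_iff_lt_rowLen.mp h
    have := YoungDiagram.mem_iff_lt_colLen.mp h
    omega
  · rfl

theorem hl_zero_add_one {D : YoungDiagram} (h : (0, 0) ∈ D) :
    hl D 0 + 1 = D.rowLen 0 + D.colLen 0 := by
  have := YoungDiagram.mem_iff_lt_rowLen.mp h
  have := YoungDiagram.mem_iff_lt_colLen.mp h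
  simp only [hl, if_pos h, hookLength, arm, leg]
  omega

theorem lt_durfee_iff {D : YoungDiagram} {i : ℕ} : i < durfee D ↔ (i, i) ∈ D := by
  constructor
  · intro h
    have := Nat.findGreatest_spec (P := fun d => ∀ i < d, ∀ j < d, (i, j) ∈ D) (Nat.zero_le D.card)
      (by simp)
    exact this i h i h
  · intro h
    -- The search bound in `durfee` is harmless, because the `i + 1` diagonal boxes are distinct
    -- boxes of `D`.
    have hcard : i + 1 ≤ D.card := by
      have : ((Finset.range (i + 1)).image (fun k => (k, k))).card ≤ D.cells.card := by
        refine Finset.card_le_card fun c hc => ?_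
        obtain ⟨k, hk, rfl⟩ := Finset.mem_image.mp hc
        have := Finset.mem_range.mp hk
        exact D.up_left_mem (by omega) (by omega) h
      rwa [Finset.card_image_of_injective _ fun x y h => (Prod.mk.inj h).1, Finset.card_range]
        at this
    exact Nat.le_findGreatest hcard fun x hx y hy => D.up_left_mem (by omega) (by omega) h

theorem durfee_bot : durfee ⊥ = 0 := by
  by_contra h
  exact YoungDiagram.notMem_bot _ (lt_durfee_iff.mp (Nat.pos_of_ne_zero h))

theorem durfee_eq_durfee_core_add_one {D : YoungDiagram} (h : (0, 0) ∈ D) :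
    durfee D = durfee (core D) + 1 := by
  refine eq_of_forall_lt_iff fun i => ?_
  rcases i with _ | i
  · simp [lt_durfee_iff, h]
  · rw [lt_durfee_iff, ← mem_core, ← lt_durfee_iff]
    omega

/-! ### Dominant fillings

The entries of these fillings are counted from `0`: the entry `k` of a filling contributes to the
row `k` of a Young diagram. -/

/-- The number of entries `k` in the row `i` of the filling `U` of `D`. -/
def rowCount (D : YoungDiagram) (U : ℕ → ℕ → ℕ) (i k : ℕ) : ℕ :=
  ((Finset.range (D.rowLen i)).filter (fun j => U i j = k)).card

/-- The number of entries `k` in the first `r` rows of the filling `U` of `D`. -/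
def topCount (D : YoungDiagram) (U : ℕ → ℕ → ℕ) (r k : ℕ) : ℕ :=
  ∑ i ∈ Finset.range r, rowCount D U i k

/-- The row lengths of the shape obtained from `A` by adding, for each entry `k` in the first `r`
rows of the filling `U` of `D`, a box to the row `k`. -/
def partialShape (A D : YoungDiagram) (U : ℕ → ℕ → ℕ) (r k : ℕ) : ℕ :=
  A.rowLen k + topCount D U r k

/-- Semistandard fillings of `D`, with value `0` outside `D`. -/
structure IsSemistandard (D : YoungDiagram) (U : ℕ → ℕ → ℕ) : Prop where
  outside : ∀ i j, (i, j) ∉ D → U i j = 0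
  row_weak : ∀ i j, (i, j + 1) ∈ D → U i j ≤ U i (j + 1)
  col_strict : ∀ i j, (i + 1, j) ∈ D → U i j < U (i + 1) j

/-- Semistandard fillings of `D` whose rows, from top to bottom, add a horizontal strip each
when they are read as instructions where to add boxes to `A`. -/
structure IsDominant (A D : YoungDiagram) (U : ℕ → ℕ → ℕ) : Prop extends IsSemistandard D U where
  interlace_of_lt : ∀ r < D.colLen 0, ∀ k,
    partialShape A D U (r + 1) (k + 1) ≤ partialShape A D U r k

/-- The shape obtained from `A` by means of the filling `U` of `D` is `nu`. -/
def HasShape (A D : YoungDiagram) (U : ℕ → ℕ → ℕ) (nu : YoungDiagram) : Prop :=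
  ∀ k, nu.rowLen k = partialShape A D U (D.colLen 0) k

theorem rowCount_pos_iff {D : YoungDiagram} {U : ℕ → ℕ → ℕ} {i k : ℕ} :
    0 < rowCount D U i k ↔ ∃ j, (i, j) ∈ D ∧ U i j = k := by
  simp [rowCount, Finset.card_pos, Finset.filter_nonempty_iff, YoungDiagram.mem_iff_lt_rowLen]

theorem topCount_succ (D : YoungDiagram) (U : ℕ → ℕ → ℕ) (r k : ℕ) :
    topCount D U (r + 1) k = topCount D U r k + rowCount D U r k :=
  Finset.sum_range_succ _ _

theorem partialShape_zero (A D : YoungDiagram) (U : ℕ → ℕ → ℕ) (k : ℕ) :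
    partialShape A D U 0 k = A.rowLen k := by
  simp [partialShape, topCount]

theorem partialShape_succ (A D : YoungDiagram) (U : ℕ → ℕ → ℕ) (r k : ℕ) :
    partialShape A D U (r + 1) k = partialShape A D U r k + rowCount D U r k := by
  rw [partialShape, topCount_succ, partialShape, add_assoc]

theorem partialShape_mono (A D : YoungDiagram) (U : ℕ → ℕ → ℕ) (k : ℕ) :
    Monotone fun r => partialShape A D U r k :=
  monotone_nat_of_le_succ fun r => by
    rw [partialShape_succ]
    exact Nat.le_add_right _ _

theorem rowCount_eq_zero {D : YoungDiagram} {i : ℕ} (h : D.colLen 0 ≤ i) (U : ℕ → ℕ → ℕ) (k : ℕ) :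
    rowCount D U i k = 0 := by
  simp [rowCount, rowLen_eq_zero h]

theorem partialShape_of_le (A : YoungDiagram) {D : YoungDiagram} (U : ℕ → ℕ → ℕ) {r : ℕ}
    (h : D.colLen 0 ≤ r) (k : ℕ) :
    partialShape A D U r k = partialShape A D U (D.colLen 0) k := by
  induction r, h using Nat.le_induction with
  | base => rfl
  | succ r h ih => rw [partialShape_succ, rowCount_eq_zero h, ih, add_zero]

namespace IsSemistandard

variable {D : YoungDiagram} {U : ℕ → ℕ → ℕ}

theorem row_mono (hU : IsSemistandard D U) {i j j' : ℕ} (hj : j ≤ j') (h : (i, j') ∈ D) :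
    U i j ≤ U i j' := by
  induction j', hj using Nat.le_induction with
  | base => exact le_rfl
  | succ m _ ih =>
    exact (ih (D.up_left_mem le_rfl m.le_succ h)).trans (hU.row_weak i m h)

theorem le_apply (hU : IsSemistandard D U) {i j : ℕ} (h : (i, j) ∈ D) : i ≤ U i j := by
  induction i with
  | zero => exact Nat.zero_le _
  | succ i ih =>
    exact (ih (D.up_left_mem i.le_succ le_rfl h)).trans_lt (hU.col_strict i j h)

/-- Entries of row `i` are at least `i`, so zeros occur only in row `0` of `D`, and the first row of
the growing shape is final after that row. -/
theorem partialShape_succ_zero (hU : IsSemistandard D U) (A : YoungDiagram) (r : ℕ) :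
    partialShape A D U (r + 1) 0 = A.rowLen 0 + rowCount D U 0 0 := by
  induction r with
  | zero => rw [partialShape_succ, partialShape_zero]
  | succ r ih =>
    rw [partialShape_succ, ih]
    have : ¬ 0 < rowCount D U (r + 1) 0 := by
      rw [rowCount_pos_iff]
      rintro ⟨j, hj, h0⟩
      have := hU.le_apply hj
      omega
    omega

end IsSemistandard

theorem rowCount_le (D : YoungDiagram) (U : ℕ → ℕ → ℕ) (i k : ℕ) :
    rowCount D U i k ≤ D.rowLen i :=
  (Finset.card_filter_le _ _).trans (Finset.card_range _).le

namespace IsDominant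

variable {A D nu : YoungDiagram} {U : ℕ → ℕ → ℕ}

/-- Every intermediate shape is a partition: the new row `k + 1` is at most the old row `k`, which
is at most the new row `k`. -/
theorem antitone (hU : IsDominant A D U) (r : ℕ) : Antitone (partialShape A D U r) := by
  have key : ∀ r ≤ D.colLen 0, Antitone (partialShape A D U r) := fun r hr =>
    antitone_nat_of_succ_le fun k => by
      rcases r with _ | r
      · simpa only [partialShape_zero] using rowLen_succ_le A k
      · exact (hU.interlace_of_lt r hr k).trans (partialShape_mono A D U k r.le_succ)
  rcases le_total r (D.colLen 0) with h | h
  · exact key r h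
  · rw [funext (partialShape_of_le A U h)]
    exact key _ le_rfl

theorem interlace (hU : IsDominant A D U) (r k : ℕ) :
    partialShape A D U (r + 1) (k + 1) ≤ partialShape A D U r k := by
  rcases lt_or_ge r (D.colLen 0) with h | h
  · exact hU.interlace_of_lt r h k
  · rw [partialShape_of_le A U h, partialShape_of_le A U (h.trans r.le_succ)]
    exact hU.antitone _ k.le_succ

theorem interlace_add (hU : IsDominant A D U) (r k t : ℕ) :
    partialShape A D U (r + t) (k + t) ≤ partialShape A D U r k := by
  induction t with
  | zero => exact le_rfl
  | succ t ih => exact (hU.interlace (r + t) (k + t)).trans ih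

/-- A horizontal strip opens at most one new row. Counting may start at any stage `s`; the stages
`0` and `1` are the ones needed later. -/
theorem partialShape_eq_zero (hU : IsDominant A D U) {s c r k : ℕ}
    (hs : ∀ k, c ≤ k → partialShape A D U s k = 0) (hr : s ≤ r) (hk : c + (r - s) ≤ k) :
    partialShape A D U r k = 0 := by
  have := hU.interlace_add s (k - (r - s)) (r - s)
  rw [hs _ (by omega), Nat.add_sub_cancel' hr, Nat.sub_add_cancel (by omega)] at this
  omega

theorem partialShape_eq_zero_of_le (hU : IsDominant A D U) {r k : ℕ} (h : A.colLen 0 + r ≤ k) :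
    partialShape A D U r k = 0 :=
  hU.partialShape_eq_zero (s := 0) (c := A.colLen 0)
    (fun k hk => by rw [partialShape_zero, rowLen_eq_zero hk]) r.zero_le h

theorem partialShape_apply_pos {i j : ℕ} (h : (i, j) ∈ D) :
    0 < partialShape A D U (i + 1) (U i j) := by
  rw [partialShape_succ]
  exact Nat.add_pos_right _ (rowCount_pos_iff.mpr ⟨j, h, rfl⟩)

theorem apply_le (hU : IsDominant A D U) {i j : ℕ} (h : (i, j) ∈ D) :
    U i j ≤ A.colLen 0 + i := by
  by_contra hlt
  have := partialShape_apply_pos (A := A) (U := U) h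
  rw [hU.partialShape_eq_zero_of_le (by omega)] at this
  exact this.false

theorem exists_hasShape (hU : IsDominant A D U) : ∃ nu, HasShape A D U nu :=
  exists_rowLen_eq (hU.antitone _) (hU.partialShape_eq_zero_of_le le_rfl)

end IsDominant

theorem HasShape.rowLen_eq {A D nu : YoungDiagram} {U : ℕ → ℕ → ℕ} (h : HasShape A D U nu) {r : ℕ}
    (hr : D.colLen 0 ≤ r) (k : ℕ) : nu.rowLen k = partialShape A D U r k := by
  rw [partialShape_of_le A U hr, h k]

/-! ### Dominant fillings for an empty diagram -/

/-- The filling of `D` in which all entries in the row `i` are `i`. -/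
def superstandard (D : YoungDiagram) (i j : ℕ) : ℕ := if (i, j) ∈ D then i else 0

theorem topCount_superstandard (D : YoungDiagram) (r k : ℕ) :
    topCount D (superstandard D) r k = if k < r then D.rowLen k else 0 := by
  have h : ∀ i, rowCount D (superstandard D) i k = if i = k then D.rowLen k else 0 := fun i => by
    have : (Finset.range (D.rowLen i)).filter (fun j => superstandard D i j = k) =
        (Finset.range (D.rowLen i)).filter (fun _ => i = k) :=
      Finset.filter_congr fun j hj => by
        rw [superstandard,
          if_pos (YoungDiagram.mem_iff_lt_rowLen.mpr (Finset.mem_range.mp hj))]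
    rw [rowCount, this]
    split_ifs with hik
    · simp [hik]
    · simp [hik]
  simp [topCount, h, Finset.sum_ite_eq']

/-- Column strictness gives entries at least `i` in row `i`; starting from the empty shape, rows `0`
to `i` open at most `i + 1` rows, so the entries are also at most `i`. -/
theorem isDominant_bot_left_iff {D : YoungDiagram} {U : ℕ → ℕ → ℕ} :
    IsDominant ⊥ D U ↔ U = superstandard D := by
  constructor
  · intro hU
    funext i j
    rw [superstandard]
    split_ifs with h
    · have := hU.apply_le h
      rw [colLen_bot, zero_add] at this
      exact this.antisymm (hU.le_apply h)
    · exact hU.outside i j h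
  · rintro rfl
    refine ⟨⟨fun i j h => if_neg h, fun i j h => ?_, fun i j h => ?_⟩, fun r _ k => ?_⟩
    · rw [superstandard, superstandard, if_pos h, if_pos (D.up_left_mem le_rfl j.le_succ h)]
    · rw [superstandard, superstandard, if_pos h, if_pos (D.up_left_mem i.le_succ le_rfl h)]
      exact i.lt_succ_self
    · simp only [partialShape, rowLen_bot, topCount_superstandard, zero_add]
      have := rowLen_succ_le D k
      split_ifs <;> omega

theorem partialShape_superstandard (D : YoungDiagram) (k : ℕ) :
    partialShape ⊥ D (superstandard D) (D.colLen 0) k = D.rowLen k := by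
  rw [partialShape, rowLen_bot, topCount_superstandard, zero_add]
  split_ifs with h
  · rfl
  · exact (rowLen_eq_zero (not_lt.mp h)).symm

theorem hasShape_superstandard_iff {D nu : YoungDiagram} :
    HasShape ⊥ D (superstandard D) nu ↔ nu = D := by
  simp only [HasShape, partialShape_superstandard]
  exact ⟨ext_rowLen, fun h k => h ▸ rfl⟩

theorem isDominant_bot_right_iff {A : YoungDiagram} {U : ℕ → ℕ → ℕ} :
    IsDominant A ⊥ U ↔ U = 0 := by
  constructor
  · intro hU
    funext i j
    exact hU.outside i j (YoungDiagram.notMem_bot _)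
  · rintro rfl
    refine ⟨⟨fun _ _ _ => rfl, fun i j h => ?_, fun i j h => ?_⟩, fun r h k => ?_⟩
    · exact absurd h (YoungDiagram.notMem_bot _)
    · exact absurd h (YoungDiagram.notMem_bot _)
    · rw [colLen_bot] at h
      omega

theorem hasShape_bot_right_iff {A nu : YoungDiagram} {U : ℕ → ℕ → ℕ} :
    HasShape A ⊥ U nu ↔ nu = A := by
  simp only [HasShape, colLen_bot, partialShape_zero]
  exact ⟨ext_rowLen, fun h k => h ▸ rfl⟩

/-! ### Dominant fillings and the removal of first rows and columns -/

/-- The filling `U` of `D` arises from the filling `V` of `core D` when `V` is moved down by one row,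
its entries are increased by `1`, a box is added at the end of each row, and a first row is added
on top.  The added boxes have the entry `0` in the first row, and then `a`, `a + 1`, … at the ends
of the rows from the row `s` on. -/
structure Extends (a s : ℕ) (D : YoungDiagram) (V U : ℕ → ℕ → ℕ) : Prop where
  first_row : ∀ j, j + 1 < D.rowLen 0 + s → U 0 j = 0
  last : ∀ i, s ≤ i → i < D.colLen 0 → U i (D.rowLen i - 1) = a + i - s
  inner : ∀ i j, (i, j) ∈ core D → U (i + 1) j = V i j + 1

namespace Extends

variable {A D : YoungDiagram} {U U' V : ℕ → ℕ → ℕ} {a s : ℕ}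

/-- Every box of `D` is in the first row, at the end of a row, or comes from `core D` moved down by
one row. -/
theorem eq_of_outside (hU : Extends a s D V U) (hU' : Extends a s D V U')
    (h : ∀ i j, (i, j) ∉ D → U i j = 0) (h' : ∀ i j, (i, j) ∉ D → U' i j = 0) (hs : s ≤ 1) :
    U = U' := by
  funext i j
  by_cases hD : (i, j) ∈ D
  · have hj := YoungDiagram.mem_iff_lt_rowLen.mp hD
    have hi := rowLen_pos_iff.mp (Nat.zero_lt_of_lt hj)
    by_cases hlast : s ≤ i ∧ j = D.rowLen i - 1
    · rw [hlast.2, hU.last i hlast.1 hi, hU'.last i hlast.1 hi]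
    · rcases i with _ | i
      · rw [hU.first_row j (by omega), hU'.first_row j (by omega)]
      · have hc : (i, j) ∈ core D := by
          rw [YoungDiagram.mem_iff_lt_rowLen, rowLen_core]
          omega
        rw [hU.inner i j hc, hU'.inner i j hc]
  · rw [h i j hD, h' i j hD]

theorem rowCount_zero_zero (hU : Extends a s D V U) (ha : 0 < a) (hs : s ≤ 1) (hD : (0, 0) ∈ D) :
    rowCount D U 0 0 + 1 = D.rowLen 0 + s := by
  have hr := YoungDiagram.mem_iff_lt_rowLen.mp hD
  have hc := YoungDiagram.mem_iff_lt_colLen.mp hD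
  have : (Finset.range (D.rowLen 0)).filter (fun j => U 0 j = 0) =
      Finset.range (D.rowLen 0 + s - 1) := by
    ext j
    rw [Finset.mem_filter, Finset.mem_range, Finset.mem_range]
    constructor
    · rintro ⟨hj, h0⟩
      by_contra hlt
      have := hU.last 0 (by omega) hc
      rw [show D.rowLen 0 - 1 = j by omega] at this
      omega
    · exact fun hj => ⟨by omega, hU.first_row j (by omega)⟩
  rw [rowCount, this, Finset.card_range]
  omega

theorem rowCount_zero_succ (hU : Extends a s D V U) (hs : s ≤ 1) (hD : (0, 0) ∈ D) (k : ℕ) :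
    rowCount D U 0 (k + 1) = if s = 0 ∧ k + 1 = a then 1 else 0 := by
  have hr := YoungDiagram.mem_iff_lt_rowLen.mp hD
  have hc := YoungDiagram.mem_iff_lt_colLen.mp hD
  split_ifs with h
  · have : (Finset.range (D.rowLen 0)).filter (fun j => U 0 j = k + 1) = {D.rowLen 0 - 1} := by
      ext j
      rw [Finset.mem_filter, Finset.mem_range, Finset.mem_singleton]
      constructor
      · rintro ⟨hj, h0⟩
        by_contra hlt
        have := hU.first_row j (by omega)
        omega
      · rintro rfl
        exact ⟨by omega, by rw [hU.last 0 (by omega) hc]; omega⟩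
    rw [rowCount, this, Finset.card_singleton]
  · by_contra hne
    obtain ⟨j, hj, h0⟩ := rowCount_pos_iff.mp (Nat.pos_of_ne_zero hne)
    have hj := YoungDiagram.mem_iff_lt_rowLen.mp hj
    by_cases hlt : j + 1 < D.rowLen 0 + s
    · have := hU.first_row j hlt
      omega
    · have := hU.last 0 (by omega) hc
      rw [show D.rowLen 0 - 1 = j by omega] at this
      omega

theorem rowCount_succ_succ (hU : Extends a s D V U) (hs : s ≤ 1) {i : ℕ} (hi : i + 1 < D.colLen 0)
    (k : ℕ) : rowCount D U (i + 1) (k + 1) =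
      rowCount (core D) V i k + if k + 1 = a + (i + 1) - s then 1 else 0 := by
  have hr := rowLen_pos_iff.mpr hi
  have hlast := hU.last (i + 1) (by omega) hi
  obtain ⟨m, hm⟩ : ∃ m, D.rowLen (i + 1) = m + 1 := ⟨_, (Nat.sub_add_cancel hr).symm⟩
  have hin : (Finset.range m).filter (fun j => U (i + 1) j = k + 1) =
      (Finset.range m).filter (fun j => V i j = k) :=
    Finset.filter_congr fun j hj => by
      rw [hU.inner i j, Nat.add_right_cancel_iff]
      rw [YoungDiagram.mem_iff_lt_rowLen, rowLen_core, hm]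
      exact Finset.mem_range.mp hj
  rw [hm, Nat.add_sub_cancel] at hlast
  rw [rowCount, rowCount, rowLen_core, hm, Nat.add_sub_cancel, Finset.range_add_one,
    Finset.filter_insert, hin, hlast]
  simp only [eq_comm (a := k + 1)]
  split_ifs with h
  · rw [Finset.card_insert_of_notMem (by simp)]
  · rfl

/-- The added indicator is the first column of the shape: after `r + 1` rows of `D` it reaches down
to `A.colLen 0 + r + 1 - s` rows, one new row for each prescribed row end. -/
theorem partialShape_succ_succ (hU : Extends (A.colLen 0) s D V U) (hs : s ≤ 1)
    (hD : (0, 0) ∈ D) {r : ℕ} (hr : r < D.colLen 0) (k : ℕ) :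
    partialShape A D U (r + 1) (k + 1) = partialShape (core A) (core D) V r k +
      if k + 1 + s < A.colLen 0 + (r + 1) then 1 else 0 := by
  induction r with
  | zero =>
    rw [partialShape_succ, partialShape_zero, partialShape_zero, hU.rowCount_zero_succ hs hD,
      rowLen_core]
    have := rowLen_pos_iff (D := A) (i := k + 1)
    split_ifs <;> omega
  | succ r ih =>
    rw [partialShape_succ, ih (by omega), hU.rowCount_succ_succ hs hr, partialShape_succ]
    split_ifs <;> omega

end Extends

namespace IsDominant

variable {A D nu : YoungDiagram} {U V : ℕ → ℕ → ℕ}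

/-- If no entry is too large in the rows above the row `s`, and the largest possible entry occurs
in the filling, then the largest possible entry occurs in each row from the row `s` on. -/
theorem apply_last (hU : IsDominant A D U) {s : ℕ} (hA : s ≤ A.colLen 0)
    (h0 : ∀ k, A.colLen 0 ≤ k → partialShape A D U s k = 0)
    (hpos : 0 < partialShape A D U (D.colLen 0) (A.colLen 0 + D.colLen 0 - 1 - s)) {i : ℕ}
    (hs : s ≤ i) (hi : i < D.colLen 0) : U i (D.rowLen i - 1) = A.colLen 0 + i - s := by
  have hr := rowLen_pos_iff.mpr hi
  have hmem : (i, D.rowLen i - 1) ∈ D := YoungDiagram.mem_iff_lt_rowLen.mpr (by omega)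
  -- The lowest possible row of the final shape is nonempty. Interlacing traces it back diagonally
  -- to row `A.colLen 0 + i - s` at stage `i + 1`. That row is still empty at stage `i`, so its
  -- entry occurs in row `i` of `D`; being the largest that fits, it stands at the end.
  have h1 := hU.interlace_add (i + 1) (A.colLen 0 + i - s) (D.colLen 0 - (i + 1))
  rw [show i + 1 + (D.colLen 0 - (i + 1)) = D.colLen 0 by omega,
    show A.colLen 0 + i - s + (D.colLen 0 - (i + 1)) = A.colLen 0 + D.colLen 0 - 1 - s by omega,
    partialShape_succ, hU.partialShape_eq_zero h0 hs (by omega), zero_add] at h1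
  obtain ⟨j, hj, hij⟩ := rowCount_pos_iff.mp (hpos.trans_le h1)
  have h2 : U i j ≤ U i (D.rowLen i - 1) :=
    hU.row_mono (by have := YoungDiagram.mem_iff_lt_rowLen.mp hj; omega) hmem
  by_contra hne
  have := partialShape_apply_pos (A := A) (U := U) hmem
  rw [hU.partialShape_eq_zero h0 (by omega) (by omega)] at this
  exact this.false

theorem rowLen_zero (hU : IsDominant A D U) (hnu : HasShape A D U nu) :
    nu.rowLen 0 = A.rowLen 0 + rowCount D U 0 0 := by
  rw [hnu.rowLen_eq (D.colLen 0).le_succ, hU.partialShape_succ_zero]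

theorem colLen_zero_le (hU : IsDominant A D U) (hnu : HasShape A D U nu) {s : ℕ}
    (hs : s ≤ D.colLen 0) (h0 : ∀ k, A.colLen 0 ≤ k → partialShape A D U s k = 0) :
    nu.colLen 0 + s ≤ A.colLen 0 + D.colLen 0 := by
  by_contra hlt
  have : 0 < nu.rowLen (A.colLen 0 + D.colLen 0 - s) := rowLen_pos_iff.mpr (by omega)
  rw [hnu, hU.partialShape_eq_zero h0 hs (by omega)] at this
  exact this.false

/-- The first row and the first column of the shape that arises from a dominant filling are not
too long together, and if they are as long as possible, then the ends of the rows of the filling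
are known. -/
theorem hook_le_and_extremal (hU : IsDominant A D U) (hnu : HasShape A D U nu) (hA : (0, 0) ∈ A)
    (hD : (0, 0) ∈ D) :
    nu.rowLen 0 + nu.colLen 0 + 1 ≤ A.rowLen 0 + D.rowLen 0 + (A.colLen 0 + D.colLen 0) ∧
    (nu.rowLen 0 + nu.colLen 0 + 1 = A.rowLen 0 + D.rowLen 0 + (A.colLen 0 + D.colLen 0) →
      ∃ s ≤ 1, nu.rowLen 0 + 1 = A.rowLen 0 + D.rowLen 0 + s ∧
        (∀ k, A.colLen 0 ≤ k → partialShape A D U s k = 0) ∧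
        (∀ j, j + 1 < D.rowLen 0 + s → U 0 j = 0) ∧
        ∀ i, s ≤ i → i < D.colLen 0 → U i (D.rowLen i - 1) = A.colLen 0 + i - s) := by
  have hDr := YoungDiagram.mem_iff_lt_rowLen.mp hD
  have hDc := YoungDiagram.mem_iff_lt_colLen.mp hD
  have hAc := YoungDiagram.mem_iff_lt_colLen.mp hA
  have hpos : ∀ s ≤ 1, nu.colLen 0 + s = A.colLen 0 + D.colLen 0 →
      0 < partialShape A D U (D.colLen 0) (A.colLen 0 + D.colLen 0 - 1 - s) := fun s hs h => by
    rw [← hnu, rowLen_pos_iff]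
    omega
  have hrow := hU.rowLen_zero hnu
  -- Rows are weakly increasing, so the last entry decides whether row `0` is all zeros (`s = 1`) or
  -- the shape loses a box in its first row (`s = 0`).
  by_cases hlast : U 0 (D.rowLen 0 - 1) = 0
  · have hz : ∀ j < D.rowLen 0, U 0 j = 0 := fun j hj => by
      have := hU.row_mono (i := 0) (j := j) (j' := D.rowLen 0 - 1) (by omega)
        (YoungDiagram.mem_iff_lt_rowLen.mpr (by omega))
      omega
    have h0 : ∀ k, A.colLen 0 ≤ k → partialShape A D U 1 k = 0 := fun k hk => by
      rw [partialShape_succ, partialShape_zero, rowLen_eq_zero hk, zero_add]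
      by_contra hne
      obtain ⟨j, hj, hk0⟩ := rowCount_pos_iff.mp (Nat.pos_of_ne_zero hne)
      rw [hz j (YoungDiagram.mem_iff_lt_rowLen.mp hj)] at hk0
      omega
    have hcol := hU.colLen_zero_le hnu hDc h0
    have := rowCount_le D U 0 0
    refine ⟨by omega, fun heq => ⟨1, le_rfl, by omega, h0, fun j hj => hz j (by omega), ?_⟩⟩
    exact fun i => hU.apply_last hAc h0 (hpos 1 le_rfl (by omega))
  · have h0 : ∀ k, A.colLen 0 ≤ k → partialShape A D U 0 k = 0 := fun k hk => by
      rw [partialShape_zero, rowLen_eq_zero hk]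
    have hcol := hU.colLen_zero_le hnu (Nat.zero_le _) h0
    have hcount : ∀ j < D.rowLen 0, U 0 j ≠ 0 → rowCount D U 0 0 ≤ j := fun j hj hne => by
      rw [rowCount]
      refine (Finset.card_le_card (t := Finset.range j) fun j' hj' => ?_).trans
        (Finset.card_range j).le
      rw [Finset.mem_filter, Finset.mem_range] at hj'
      rw [Finset.mem_range]
      by_contra hlt
      have := hU.row_mono (not_lt.mp hlt) (YoungDiagram.mem_iff_lt_rowLen.mpr hj'.1)
      omega
    have := hcount (D.rowLen 0 - 1) (by omega) hlast
    refine ⟨by omega, fun heq => ⟨0, zero_le_one, by omega, h0, fun j hj => ?_, ?_⟩⟩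
    · by_contra hne
      have := hcount j (by omega) hne
      omega
    · exact fun i => hU.apply_last (Nat.zero_le _) h0 (hpos 0 zero_le_one (by omega))

/-- A dominant filling whose shape has the longest possible first hook extends a dominant filling
of the diagrams without their first rows and columns. -/
theorem exists_extends (hU : IsDominant A D U) (hnu : HasShape A D U nu) (hA : (0, 0) ∈ A)
    (hD : (0, 0) ∈ D)
    (heq : nu.rowLen 0 + nu.colLen 0 + 1 = A.rowLen 0 + D.rowLen 0 + (A.colLen 0 + D.colLen 0)) :
    ∃ s ≤ 1, nu.rowLen 0 + 1 = A.rowLen 0 + D.rowLen 0 + s ∧ ∃ V, IsDominant (core A) (core D) V ∧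
      HasShape (core A) (core D) V (core nu) ∧ Extends (A.colLen 0) s D V U := by
  obtain ⟨s, hs, hrow, h0, hfirst, hlast⟩ := (hU.hook_le_and_extremal hnu hA hD).2 heq
  have hDc := YoungDiagram.mem_iff_lt_colLen.mp hD
  have hcore := colLen_core_zero_le D
  let V : ℕ → ℕ → ℕ := fun i j => if (i, j) ∈ core D then U (i + 1) j - 1 else 0
  have hmem : ∀ {i j}, (i, j) ∈ core D → (i + 1, j) ∈ D := fun {i j} h =>
    D.up_left_mem le_rfl j.le_succ (mem_core.mp h)
  have hV : ∀ {i j}, (i, j) ∈ core D → U (i + 1) j = V i j + 1 := fun {i j} h => by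
    have := hU.le_apply (hmem h)
    simp only [V, if_pos h]
    omega
  have hext : Extends (A.colLen 0) s D V U := ⟨hfirst, hlast, fun i j => hV⟩
  have hshape := fun {r} => hext.partialShape_succ_succ hs hD (r := r)
  refine ⟨s, hs, hrow, V, ⟨⟨fun i j h => if_neg h, fun i j h => ?_, fun i j h => ?_⟩,
    fun r hr k => ?_⟩, fun k => ?_, hext⟩
  · have h1 := hV h
    have h2 := hV ((core D).up_left_mem le_rfl j.le_succ h)
    have := hU.row_weak (i + 1) j (hmem h)
    omega
  · have h1 := hV h
    have h2 := hV ((core D).up_left_mem i.le_succ le_rfl h)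
    have := hU.col_strict (i + 1) j (hmem h)
    omega
  · have h1 := hshape (r := r + 1) (by omega) (k + 1)
    have h2 := hshape (r := r) (by omega) k
    have := hU.interlace (r + 1) (k + 1)
    -- The two indicators agree, since row and stage both move by one; hence interlacing passes to
    -- the cores.
    split_ifs at h1 h2 <;> omega
  · rw [rowLen_core, hnu, ← partialShape_of_le (r := D.colLen 0 - 1) _ _ hcore]
    have h1 := hshape (r := D.colLen 0 - 1) (by omega) k
    rw [Nat.sub_add_cancel hDc] at h1
    split_ifs at h1 with hk
    · omega
    · rw [hU.partialShape_eq_zero h0 (by omega) (by omega)] at h1 ⊢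
      omega

/-- Every dominant filling of the diagrams without their first rows and columns can be extended, in
two ways. -/
theorem exists_extension (hV : IsDominant (core A) (core D) V) (hA : (0, 0) ∈ A)
    (hD : (0, 0) ∈ D) {s : ℕ} (hs : s ≤ 1) :
    ∃ U, IsDominant A D U ∧ Extends (A.colLen 0) s D V U := by
  have hAr := YoungDiagram.mem_iff_lt_rowLen.mp hA
  have hAc := YoungDiagram.mem_iff_lt_colLen.mp hA
  have hDr := YoungDiagram.mem_iff_lt_rowLen.mp hD
  have hDc := YoungDiagram.mem_iff_lt_colLen.mp hD
  have hAcore := colLen_core_zero_le A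
  have hDcore := colLen_core_zero_le D
  -- For `i = 0` the branch with `V` is never reached, and the last branch only when `s = 0`; so
  -- neither `i - 1` nor `i - s` truncates where it is used.
  let U : ℕ → ℕ → ℕ := fun i j =>
    if (i, j) ∈ D then
      if i = 0 ∧ j + 1 < D.rowLen 0 + s then 0
      else if j + 1 < D.rowLen i then V (i - 1) j + 1 else A.colLen 0 + i - s
    else 0
  have hout : ∀ {i j}, (i, j) ∉ D → U i j = 0 := fun h => if_neg h
  have hfirst : ∀ j, j + 1 < D.rowLen 0 + s → U 0 j = 0 := fun j hj => by
    simp only [U, hj, and_self, if_true, ite_self]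
  have hend : ∀ {i j}, s ≤ i → j + 1 = D.rowLen i → U i j = A.colLen 0 + i - s :=
    fun {i j} hi hj => by
      have hmem : (i, j) ∈ D := YoungDiagram.mem_iff_lt_rowLen.mpr (by omega)
      simp only [U, if_pos hmem]
      rw [if_neg, if_neg (by omega)]
      rintro ⟨rfl, h⟩
      omega
  have hinner : ∀ {i j}, j + 1 < D.rowLen (i + 1) → U (i + 1) j = V i j + 1 := fun {i j} hj => by
    have hmem : (i + 1, j) ∈ D := YoungDiagram.mem_iff_lt_rowLen.mpr (by omega)
    simp only [U, if_pos hmem, if_pos hj, Nat.add_sub_cancel]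
    rw [if_neg (by omega)]
  have hcore : ∀ {i j}, (i, j) ∈ core D ↔ j + 1 < D.rowLen (i + 1) := fun {i j} => by
    rw [mem_core, YoungDiagram.mem_iff_lt_rowLen]
  have hext : Extends (A.colLen 0) s D V U := by
    refine ⟨hfirst, fun i hi hiD => hend hi ?_, fun i j h => hinner (hcore.mp h)⟩
    exact Nat.sub_add_cancel (rowLen_pos_iff.mpr hiD)
  -- `core A` has fewer rows than `A`, so the shifted entries of `V` never exceed the prescribed row
  -- ends.
  have hVle : ∀ {i j}, j + 1 < D.rowLen (i + 1) → V i j + 1 ≤ A.colLen 0 + i := fun {i j} hj => by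
    have := hV.apply_le (hcore.mpr hj)
    omega
  have hshape := fun {r} => hext.partialShape_succ_succ hs hD (r := r)
  have hss : IsSemistandard D U := by
    refine ⟨fun i j => hout, fun i j h => ?_, fun i j h => ?_⟩
    · have hj := YoungDiagram.mem_iff_lt_rowLen.mp h
      rcases i with _ | i
      · rw [hfirst j (by omega)]
        exact Nat.zero_le _
      · rw [hinner hj]
        rcases (show j + 1 + 1 ≤ D.rowLen (i + 1) from hj).lt_or_eq with hlt | heq
        · rw [hinner hlt]
          exact Nat.succ_le_succ (hV.row_weak i j (hcore.mpr hlt))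
        · rw [hend (by omega) heq]
          have := hVle hj
          omega
    · have hj := YoungDiagram.mem_iff_lt_rowLen.mp h
      have hle := rowLen_succ_le D i
      -- The box below is either a row end, larger than anything row `i` can hold, or it comes from
      -- `V`; in the latter case the box above is not a row end.
      have hbelow : A.colLen 0 + i - s < U (i + 1) j ∨ j + 1 < D.rowLen (i + 1) := by
        rcases (show j + 1 ≤ D.rowLen (i + 1) from hj).lt_or_eq with hlt | heq
        · exact Or.inr hlt
        · rw [hend (by omega) heq]
          omega
      rcases i with _ | i
      · by_cases h0 : j + 1 < D.rowLen 0 + s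
        · rw [hfirst j h0]
          rcases hbelow with h1 | h1
          · omega
          · rw [hinner h1]
            omega
        · rw [hend (by omega) (by omega)]
          rcases hbelow with h1 | h1 <;> omega
      · rcases hbelow with h1 | h1
        · refine lt_of_le_of_lt ?_ h1
          rcases (show j + 1 ≤ D.rowLen (i + 1) by omega).lt_or_eq with hlt | heq
          · rw [hinner hlt]
            have := hVle hlt
            omega
          · rw [hend (by omega) heq]
        · rw [hinner h1, hinner (by omega)]
          exact Nat.succ_lt_succ (hV.col_strict i j (hcore.mpr h1))
  refine ⟨U, ⟨hss, fun r hr k => ?_⟩, hext⟩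
  rcases r with _ | r
  · rw [hshape hDc, partialShape_zero, partialShape_zero, rowLen_core]
    have := rowLen_succ_le A k
    have := rowLen_pos_iff (D := A) (i := k)
    split_ifs <;> omega
  · rw [hshape hr]
    rcases k with _ | k
    -- `hshape` does not cover row `0`. Its length is `A.rowLen 0 + D.rowLen 0 + s - 1`, and the row
    -- below has at most the two first rows of the cores plus one box.
    · rw [hss.partialShape_succ_zero]
      have h1 := hext.rowCount_zero_zero hAc hs hD
      have h2 := hV.toIsSemistandard.partialShape_succ_zero (core A) r
      have h3 := rowCount_le (core D) V 0 0
      rw [rowLen_core] at h2 h3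
      have := rowLen_succ_le A 0
      have := rowLen_succ_le D 0
      split_ifs <;> omega
    · rw [hshape (by omega)]
      have := hV.interlace r k
      split_ifs <;> omega

/-- The shape of an extension. -/
theorem shape_of_extends (hU : IsDominant A D U) (hV : IsDominant (core A) (core D) V)
    (hnu : HasShape A D U nu) {rho : YoungDiagram} (hrho : HasShape (core A) (core D) V rho)
    (hA : (0, 0) ∈ A) (hD : (0, 0) ∈ D) {s : ℕ} (hs : s ≤ 1) (hext : Extends (A.colLen 0) s D V U) :
    core nu = rho ∧ nu.rowLen 0 + 1 = A.rowLen 0 + D.rowLen 0 + s ∧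
      nu.rowLen 0 + nu.colLen 0 + 1 = A.rowLen 0 + D.rowLen 0 + (A.colLen 0 + D.colLen 0) := by
  have hAr := YoungDiagram.mem_iff_lt_rowLen.mp hA
  have hAc := YoungDiagram.mem_iff_lt_colLen.mp hA
  have hDc := YoungDiagram.mem_iff_lt_colLen.mp hD
  have hAcore := colLen_core_zero_le A
  have hDcore := colLen_core_zero_le D
  have hrow : nu.rowLen 0 + 1 = A.rowLen 0 + D.rowLen 0 + s := by
    have := hU.rowLen_zero hnu
    have := hext.rowCount_zero_zero hAc hs hD
    omega
  have hsucc : ∀ k, nu.rowLen (k + 1) =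
      rho.rowLen k + if k + 1 + s < A.colLen 0 + D.colLen 0 then 1 else 0 := fun k => by
    have := hext.partialShape_succ_succ hs hD (r := D.colLen 0 - 1) (by omega) k
    rwa [Nat.sub_add_cancel hDc, ← hnu, ← hrho.rowLen_eq hDcore] at this
  refine ⟨ext_rowLen fun k => ?_, hrow, ?_⟩
  · rw [rowLen_core, hsucc]
    split_ifs with h
    · rfl
    · rw [hrho, hV.partialShape_eq_zero_of_le (by omega)]
  · have hle := (hU.hook_le_and_extremal hnu hA hD).1
    -- This is the lower bound for the first column; the upper bound comes from the hook inequality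
    -- `hle`.
    have : A.colLen 0 + D.colLen 0 - s - 1 < nu.colLen 0 := by
      rw [← rowLen_pos_iff]
      rcases hm : A.colLen 0 + D.colLen 0 - s - 1 with _ | m
      · have := hU.rowLen_zero hnu
        omega
      · rw [hsucc, if_pos (by omega)]
        omega
    omega

end IsDominant

/-! ### Shapes with the greatest principal hook lengths -/

theorem toLex_le_of_head_lt {f g : ℕ → ℕ} (h : f 0 < g 0) : toLex f ≤ toLex g :=
  le_of_lt ⟨0, fun _ hj => absurd hj (Nat.not_lt_zero _), h⟩

theorem toLex_le_of_tail_le {f g : ℕ → ℕ} (h0 : f 0 = g 0)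
    (h : toLex (fun i => f (i + 1)) ≤ toLex (fun i => g (i + 1))) : toLex f ≤ toLex g := by
  rcases h.lt_or_eq with ⟨i, hi, hlt⟩ | heq
  · refine le_of_lt ⟨i + 1, fun j hj => ?_, hlt⟩
    rcases j with _ | j
    · exact h0
    · exact hi j (Nat.lt_of_succ_lt_succ hj)
  · refine le_of_eq (congrArg toLex (funext fun j => ?_))
    rcases j with _ | j
    · exact h0
    · exact congrFun (toLex.injective heq) j

theorem hl_core_add (A D : YoungDiagram) :
    hl (core A) + hl (core D) = fun i => (hl A + hl D) (i + 1) :=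
  funext fun i => by simp only [Pi.add_apply, hl_core]

theorem HasShape.zero_mem {A D nu : YoungDiagram} {U : ℕ → ℕ → ℕ} (hnu : HasShape A D U nu)
    (hA : (0, 0) ∈ A) : (0, 0) ∈ nu := by
  rw [YoungDiagram.mem_iff_lt_rowLen] at hA ⊢
  rw [hnu, partialShape]
  omega

theorem hl_zero_eq_iff {A D nu : YoungDiagram} {U : ℕ → ℕ → ℕ} (hnu : HasShape A D U nu)
    (hA : (0, 0) ∈ A) (hD : (0, 0) ∈ D) :
    hl nu 0 = (hl A + hl D) 0 ↔
      nu.rowLen 0 + nu.colLen 0 + 1 = A.rowLen 0 + D.rowLen 0 + (A.colLen 0 + D.colLen 0) := by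
  have h1 := hl_zero_add_one hA
  have h2 := hl_zero_add_one hD
  have h3 := hl_zero_add_one (hnu.zero_mem hA)
  rw [Pi.add_apply]
  omega

theorem toLex_hl_le (A D : YoungDiagram) : ∀ U nu, IsDominant A D U → HasShape A D U nu →
    toLex (hl nu) ≤ toLex (hl A + hl D) := by
  induction A, D using core_induction with
  | bot_left D =>
    intro U nu hU hnu
    obtain rfl := isDominant_bot_left_iff.mp hU
    rw [hasShape_superstandard_iff.mp hnu, hl_bot, zero_add]
  | bot_right A =>
    intro U nu _ hnu
    rw [hasShape_bot_right_iff.mp hnu, hl_bot, add_zero]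
  | step A D hA hD ih =>
    intro U nu hU hnu
    by_cases h0 : hl nu 0 = (hl A + hl D) 0
    · obtain ⟨s, -, -, V, hV, hcore, -⟩ :=
        hU.exists_extends hnu hA hD ((hl_zero_eq_iff hnu hA hD).mp h0)
      have := ih V (core nu) hV hcore
      rw [hl_core_add, funext (hl_core nu)] at this
      exact toLex_le_of_tail_le h0 this
    · refine toLex_le_of_head_lt (lt_of_le_of_ne ?_ h0)
      have h1 := hl_zero_add_one hA
      have h2 := hl_zero_add_one hD
      have h3 := hl_zero_add_one (hnu.zero_mem hA)
      have h4 := (hU.hook_le_and_extremal hnu hA hD).1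
      rw [Pi.add_apply]
      omega

theorem hl_tail_eq {A D nu : YoungDiagram} (h : hl nu = hl A + hl D) :
    hl (core nu) = hl (core A) + hl (core D) := by
  rw [hl_core_add, ← h]
  exact funext (hl_core nu)

/-- The first row length of `nu` determines `s`, induction determines the filling for the cores, and
the two together determine the extension. -/
theorem eq_of_hl_eq (A D : YoungDiagram) : ∀ U U' nu, IsDominant A D U → IsDominant A D U' →
    HasShape A D U nu → HasShape A D U' nu → hl nu = hl A + hl D → U = U' := by
  induction A, D using core_induction with
  | bot_left D =>
    intro U U' _ hU hU' _ _ _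
    rw [isDominant_bot_left_iff.mp hU, isDominant_bot_left_iff.mp hU']
  | bot_right A =>
    intro U U' _ hU hU' _ _ _
    rw [isDominant_bot_right_iff.mp hU, isDominant_bot_right_iff.mp hU']
  | step A D hA hD ih =>
    intro U U' nu hU hU' hnu hnu' h
    have heq := (hl_zero_eq_iff hnu hA hD).mp (congrFun h 0)
    obtain ⟨s, hs, hrow, V, hV, hcore, hext⟩ := hU.exists_extends hnu hA hD heq
    obtain ⟨s', -, hrow', V', hV', hcore', hext'⟩ := hU'.exists_extends hnu' hA hD heq
    obtain rfl : s = s' := by omega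
    obtain rfl := ih V V' _ hV hV' hcore hcore' (hl_tail_eq h)
    exact hext.eq_of_outside hext' hU.outside hU'.outside hs

/-- The shapes with the greatest principal hook lengths that arise from dominant fillings. -/
def extremalShapes (A D : YoungDiagram) : Set YoungDiagram :=
  {nu | (∃ U, IsDominant A D U ∧ HasShape A D U nu) ∧ hl nu = hl A + hl D}

/-- For fixed `s`, taking cores is a bijection onto the extremal shapes of the cores: `s` and the
extremal hook fix the first row and column, and `exists_extension` gives surjectivity. -/
theorem encard_extremalShapes_rowLen {A D : YoungDiagram} (hA : (0, 0) ∈ A) (hD : (0, 0) ∈ D)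
    {s : ℕ} (hs : s ≤ 1) :
    (extremalShapes A D ∩ {nu | nu.rowLen 0 + 1 = A.rowLen 0 + D.rowLen 0 + s}).encard =
      (extremalShapes (core A) (core D)).encard := by
  have hinj : Set.InjOn core
      (extremalShapes A D ∩ {nu | nu.rowLen 0 + 1 = A.rowLen 0 + D.rowLen 0 + s}) := by
    rintro nu ⟨⟨⟨U, hU, hnu⟩, h⟩, hrow⟩ nu' ⟨⟨⟨U', hU', hnu'⟩, h'⟩, hrow'⟩ hcore
    have h0 := (hl_zero_eq_iff hnu hA hD).mp (congrFun h 0)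
    have h0' := (hl_zero_eq_iff hnu' hA hD).mp (congrFun h' 0)
    have h1 : nu.rowLen 0 + 1 = A.rowLen 0 + D.rowLen 0 + s := hrow
    have h1' : nu'.rowLen 0 + 1 = A.rowLen 0 + D.rowLen 0 + s := hrow'
    exact ext_core (by omega) (by omega) hcore
  rw [← hinj.encard_image]
  congr 1
  ext rho
  constructor
  · rintro ⟨nu, ⟨⟨⟨U, hU, hnu⟩, h⟩, -⟩, rfl⟩
    obtain ⟨-, -, -, V, hV, hcore, -⟩ :=
      hU.exists_extends hnu hA hD ((hl_zero_eq_iff hnu hA hD).mp (congrFun h 0))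
    exact ⟨⟨V, hV, hcore⟩, hl_tail_eq h⟩
  · rintro ⟨⟨V, hV, hrho⟩, h⟩
    obtain ⟨U, hU, hext⟩ := hV.exists_extension hA hD hs
    obtain ⟨nu, hnu⟩ := hU.exists_hasShape
    obtain ⟨rfl, hrow, heq⟩ := hU.shape_of_extends hV hnu hrho hA hD hs hext
    refine ⟨nu, ⟨⟨⟨U, hU, hnu⟩, funext fun i => ?_⟩, hrow⟩, rfl⟩
    rcases i with _ | i
    · exact (hl_zero_eq_iff hnu hA hD).mpr heq
    · rw [← hl_core, h, hl_core_add]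

theorem encard_extremalShapes (A D : YoungDiagram) :
    (extremalShapes A D).encard = (2 ^ min (durfee A) (durfee D) : ℕ) := by
  induction A, D using core_induction with
  | bot_left D =>
    have : extremalShapes ⊥ D = {D} := by
      ext nu
      simp only [extremalShapes, isDominant_bot_left_iff, exists_eq_left,
        hasShape_superstandard_iff, hl_bot, zero_add, Set.mem_ofPred_eq, Set.mem_singleton_iff]
      exact and_iff_left_of_imp fun h => h ▸ rfl
    rw [this, durfee_bot, Nat.zero_min, pow_zero, Set.encard_singleton, Nat.cast_one]
  | bot_right A =>
    have : extremalShapes A ⊥ = {A} := by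
      ext nu
      simp only [extremalShapes, isDominant_bot_right_iff, exists_eq_left,
        hasShape_bot_right_iff, hl_bot, add_zero, Set.mem_ofPred_eq, Set.mem_singleton_iff]
      exact and_iff_left_of_imp fun h => h ▸ rfl
    rw [this, durfee_bot, Nat.min_zero, pow_zero, Set.encard_singleton, Nat.cast_one]
  | step A D hA hD ih =>
    have hunion : extremalShapes A D =
        extremalShapes A D ∩ {nu | nu.rowLen 0 + 1 = A.rowLen 0 + D.rowLen 0 + 0} ∪
        extremalShapes A D ∩ {nu | nu.rowLen 0 + 1 = A.rowLen 0 + D.rowLen 0 + 1} := by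
      rw [← Set.inter_union_distrib_left, eq_comm, Set.inter_eq_left]
      rintro nu ⟨⟨U, hU, hnu⟩, h⟩
      obtain ⟨s, hs, hrow, -⟩ :=
        hU.exists_extends hnu hA hD ((hl_zero_eq_iff hnu hA hD).mp (congrFun h 0))
      rcases Nat.le_one_iff_eq_zero_or_eq_one.mp hs with rfl | rfl
      · exact Or.inl hrow
      · exact Or.inr hrow
    have hdisj : Disjoint
        (extremalShapes A D ∩ {nu | nu.rowLen 0 + 1 = A.rowLen 0 + D.rowLen 0 + 0})
        (extremalShapes A D ∩ {nu | nu.rowLen 0 + 1 = A.rowLen 0 + D.rowLen 0 + 1}) := by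
      rw [Set.disjoint_left]
      rintro nu ⟨-, h⟩ ⟨-, h'⟩
      have h0 : nu.rowLen 0 + 1 = A.rowLen 0 + D.rowLen 0 + 0 := h
      have h1 : nu.rowLen 0 + 1 = A.rowLen 0 + D.rowLen 0 + 1 := h'
      omega
    rw [hunion, Set.encard_union_eq hdisj, encard_extremalShapes_rowLen hA hD zero_le_one,
      encard_extremalShapes_rowLen hA hD le_rfl, ih, durfee_eq_durfee_core_add_one hA,
      durfee_eq_durfee_core_add_one hD, Nat.add_min_add_right, pow_succ, mul_two, Nat.cast_add]

/-! ### Dominant fillings and Littlewood-Richardson tableaux -/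

/-- The number of entries `k` of the filling `U` of `D` that are read no later than the box
`(r, j)`. -/
def prefixCount (D : YoungDiagram) (U : ℕ → ℕ → ℕ) (r j k : ℕ) : ℕ :=
  topCount D U r k + ((Finset.range (D.rowLen r)).filter (fun j' => j ≤ j' ∧ U r j' = k)).card

theorem topCount_le_prefixCount (D : YoungDiagram) (U : ℕ → ℕ → ℕ) (r j k : ℕ) :
    topCount D U r k ≤ prefixCount D U r j k :=
  Nat.le_add_right _ _

theorem prefixCount_le_topCount (D : YoungDiagram) (U : ℕ → ℕ → ℕ) (r j k : ℕ) :
    prefixCount D U r j k ≤ topCount D U (r + 1) k := by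
  rw [topCount_succ]
  exact Nat.add_le_add_left
    (Finset.card_le_card (Finset.monotone_filter_right _ fun _ _ h => h.2)) _

theorem prefixCount_zero (D : YoungDiagram) (U : ℕ → ℕ → ℕ) (r k : ℕ) :
    prefixCount D U r 0 k = topCount D U (r + 1) k := by
  simp only [prefixCount, topCount_succ, rowCount, Nat.zero_le, true_and]

/-- Within a row read from right to left, the lattice condition for `k` and `k + 1` is tightest when
all entries `k + 1` and no `k` have been read. That instant is the interlacing inequality. -/
theorem isDominant_iff_lattice {A D : YoungDiagram} {U : ℕ → ℕ → ℕ} (hU : IsSemistandard D U) :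
    IsDominant A D U ↔ ∀ r j, (r, j) ∈ D → ∀ k,
      A.rowLen (k + 1) + prefixCount D U r j (k + 1) ≤ A.rowLen k + prefixCount D U r j k := by
  constructor
  · intro h r j _ k
    have h1 := h.interlace r k
    have h2 := prefixCount_le_topCount D U r j (k + 1)
    have h3 := topCount_le_prefixCount D U r j k
    rw [partialShape, partialShape] at h1
    omega
  · intro h
    refine ⟨hU, fun r hr k => ?_⟩
    -- The critical box is the leftmost one with an entry at least `k + 1`. Without such a box the
    -- row adds nothing to row `k + 1`, and the end of the previous row (or `A` itself) gives the
    -- inequality.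
    by_cases hex : ∃ j, (r, j) ∈ D ∧ k + 1 ≤ U r j
    · classical
      obtain ⟨hmem, hle⟩ := Nat.find_spec hex
      have hmin := fun {m} => Nat.find_min hex (m := m)
      set j := Nat.find hex
      have h1 : prefixCount D U r j (k + 1) = topCount D U (r + 1) (k + 1) := by
        rw [prefixCount, topCount_succ, rowCount]
        congr 2
        refine Finset.filter_congr fun j' hj' => and_iff_right_of_imp fun heq => ?_
        by_contra hlt
        exact hmin (not_le.mp hlt)
          ⟨YoungDiagram.mem_iff_lt_rowLen.mpr (Finset.mem_range.mp hj'), heq.ge⟩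
      have h2 : prefixCount D U r j k = topCount D U r k := by
        rw [prefixCount, Finset.filter_false_of_mem, Finset.card_empty, add_zero]
        rintro j' hj' ⟨hjj', heq⟩
        have := hU.row_mono hjj' (YoungDiagram.mem_iff_lt_rowLen.mpr (Finset.mem_range.mp hj'))
        omega
      have := h r j hmem k
      rwa [h1, h2] at this
    · have hzero : rowCount D U r (k + 1) = 0 := by
        by_contra hne
        obtain ⟨j, hj, heq⟩ := rowCount_pos_iff.mp (Nat.pos_of_ne_zero hne)
        exact hex ⟨j, hj, heq.ge⟩
      rw [partialShape_succ, hzero, add_zero]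
      rcases r with _ | r
      · rw [partialShape_zero, partialShape_zero]
        exact rowLen_succ_le A k
      · have := h r 0 (YoungDiagram.mem_iff_lt_colLen.mpr (by omega)) k
        rwa [prefixCount_zero, prefixCount_zero] at this

theorem card_filter_row (D : YoungDiagram) (r : ℕ) (P : ℕ → Prop) [DecidablePred P] :
    (D.cells.filter (fun c => c.1 = r ∧ P c.2)).card =
      ((Finset.range (D.rowLen r)).filter P).card := by
  rw [← Finset.card_image_of_injective ((Finset.range (D.rowLen r)).filter P)
    (Prod.mk_right_injective r)]
  congr 1
  ext ⟨i, j⟩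
  simp only [Finset.mem_filter, Finset.mem_image, YoungDiagram.mem_cells, Finset.mem_range,
    Prod.mk.injEq]
  constructor
  · rintro ⟨h, rfl, hP⟩
    exact ⟨j, ⟨YoungDiagram.mem_iff_lt_rowLen.mp h, hP⟩, rfl, rfl⟩
  · rintro ⟨j, ⟨h, hP⟩, rfl, rfl⟩
    exact ⟨YoungDiagram.mem_iff_lt_rowLen.mpr h, rfl, hP⟩

theorem card_filter_lt_row (D : YoungDiagram) (U : ℕ → ℕ → ℕ) (r k : ℕ) :
    (D.cells.filter (fun c => c.1 < r ∧ U c.1 c.2 = k)).card = topCount D U r k := by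
  induction r with
  | zero => simp [topCount]
  | succ r ih =>
    rw [topCount_succ, ← ih, rowCount, ← card_filter_row, ← Finset.card_union_of_disjoint,
      ← Finset.filter_or]
    · refine congrArg Finset.card (Finset.filter_congr fun c _ => ?_)
      constructor
      · rintro ⟨h, hk⟩
        rcases (Nat.lt_succ_iff.mp h).lt_or_eq with h | h
        · exact Or.inl ⟨h, hk⟩
        · exact Or.inr ⟨h, h ▸ hk⟩
      · rintro (⟨h, hk⟩ | ⟨h, hk⟩)
        · exact ⟨by omega, hk⟩
        · exact ⟨by omega, h ▸ hk⟩
    · refine Finset.disjoint_filter.mpr fun c _ h h' => ?_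
      omega

theorem card_filter_read (D : YoungDiagram) (U : ℕ → ℕ → ℕ) (r j k : ℕ) :
    (D.cells.filter (fun c => (c.1 < r ∨ (c.1 = r ∧ j ≤ c.2)) ∧ U c.1 c.2 = k)).card =
      prefixCount D U r j k := by
  rw [prefixCount, ← card_filter_lt_row, ← card_filter_row, ← Finset.card_union_of_disjoint,
    ← Finset.filter_or]
  · refine congrArg Finset.card (Finset.filter_congr fun c _ => ?_)
    constructor
    · rintro ⟨h | ⟨h, hj⟩, hk⟩
      · exact Or.inl ⟨h, hk⟩
      · exact Or.inr ⟨h, hj, h ▸ hk⟩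
    · rintro (⟨h, hk⟩ | ⟨h, hj, hk⟩)
      · exact ⟨Or.inl h, hk⟩
      · exact ⟨Or.inr ⟨h, hj⟩, h ▸ hk⟩
  · refine Finset.disjoint_filter.mpr fun c _ h h' => ?_
    omega

/-! ### Passing between a translate and its diagram -/

theorem mem_translate {D : YoungDiagram} {p x : ℕ × ℕ} :
    x ∈ translate D p ↔ ∃ i j, (i, j) ∈ D ∧ x = (i + p.1, j + p.2) := by
  simp only [translate, Finset.mem_map, YoungDiagram.mem_cells, addRightEmbedding_apply,
    Prod.exists, Prod.ext_iff, Prod.fst_add, Prod.snd_add, eq_comm]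

theorem add_mem_translate {D : YoungDiagram} {p : ℕ × ℕ} {i j : ℕ} :
    (i + p.1, j + p.2) ∈ translate D p ↔ (i, j) ∈ D := by
  rw [mem_translate]
  constructor
  · rintro ⟨i', j', h, heq⟩
    obtain ⟨h1, h2⟩ := Prod.mk.inj heq
    rwa [Nat.add_right_cancel h1, Nat.add_right_cancel h2]
  · exact fun h => ⟨i, j, h, rfl⟩

/-- The filling of `D` that corresponds to the filling `T` of a translate of `D` by positive
integers. -/
def localFilling (D : YoungDiagram) (p : ℕ × ℕ) (T : ℕ → ℕ → ℕ) (i j : ℕ) : ℕ :=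
  if (i, j) ∈ D then T (i + p.1) (j + p.2) - 1 else 0

section localFilling

variable {D : YoungDiagram} {p : ℕ × ℕ} {T : ℕ → ℕ → ℕ}

theorem apply_add_eq_localFilling_add_one (hpos : ∀ x ∈ translate D p, 1 ≤ T x.1 x.2) {i j : ℕ}
    (h : (i, j) ∈ D) : T (i + p.1) (j + p.2) = localFilling D p T i j + 1 := by
  have : 1 ≤ T (i + p.1) (j + p.2) := hpos _ (add_mem_translate.mpr h)
  rw [localFilling, if_pos h, Nat.sub_add_cancel this]

theorem countEntry_translate_filter (hpos : ∀ x ∈ translate D p, 1 ≤ T x.1 x.2)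
    (P : ℕ × ℕ → Prop) [DecidablePred P] (k : ℕ) :
    countEntry ((translate D p).filter P) T (k + 1) =
      (D.cells.filter (fun c => P (c + p) ∧ localFilling D p T c.1 c.2 = k)).card := by
  rw [countEntry, Finset.filter_filter, translate, Finset.filter_map, Finset.card_map]
  refine congrArg Finset.card (Finset.filter_congr fun c hc => and_congr_right fun _ => ?_)
  rw [← Nat.add_right_cancel_iff (m := localFilling D p T c.1 c.2) (n := 1),
    ← apply_add_eq_localFilling_add_one hpos hc]
  rfl

theorem countEntry_translate (hpos : ∀ x ∈ translate D p, 1 ≤ T x.1 x.2) (k : ℕ) :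
    countEntry (translate D p) T (k + 1) = topCount D (localFilling D p T) (D.colLen 0) k := by
  have := countEntry_translate_filter hpos (fun _ => True) k
  rw [Finset.filter_true] at this
  rw [this, ← card_filter_lt_row]
  refine congrArg Finset.card (Finset.filter_congr fun c hc => and_congr_left fun _ => ?_)
  rw [true_iff, ← YoungDiagram.mem_iff_lt_colLen]
  exact D.up_left_mem le_rfl (Nat.zero_le _) hc

theorem countEntry_readUpTo_translate (hpos : ∀ x ∈ translate D p, 1 ≤ T x.1 x.2) (r j k : ℕ) :
    countEntry (readUpTo (translate D p) (r + p.1, j + p.2)) T (k + 1) =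
      prefixCount D (localFilling D p T) r j k := by
  rw [readUpTo, countEntry_translate_filter hpos, ← card_filter_read]
  refine congrArg Finset.card (Finset.filter_congr fun c hc => and_congr_left fun _ => ?_)
  simp only [Prod.fst_add, Prod.snd_add]
  omega

theorem isSemistandard_localFilling_iff (hpos : ∀ x ∈ translate D p, 1 ≤ T x.1 x.2) :
    IsSemistandard D (localFilling D p T) ↔
      (∀ i j, (i, j) ∈ translate D p → (i, j + 1) ∈ translate D p → T i j ≤ T i (j + 1)) ∧
      ∀ i j, (i, j) ∈ translate D p → (i + 1, j) ∈ translate D p → T i j < T (i + 1) j := by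
  have hT := fun {i j} => apply_add_eq_localFilling_add_one hpos (i := i) (j := j)
  constructor
  · intro h
    refine ⟨fun x y hx hy => ?_, fun x y hx hy => ?_⟩
    · obtain ⟨i, j, hij, heq⟩ := mem_translate.mp hx
      obtain ⟨rfl, rfl⟩ := Prod.mk.inj heq
      rw [Nat.add_right_comm, add_mem_translate] at hy
      rw [Nat.add_right_comm, hT hij, hT hy]
      exact Nat.succ_le_succ (h.row_weak i j hy)
    · obtain ⟨i, j, hij, heq⟩ := mem_translate.mp hx
      obtain ⟨rfl, rfl⟩ := Prod.mk.inj heq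
      rw [Nat.add_right_comm, add_mem_translate] at hy
      rw [Nat.add_right_comm, hT hij, hT hy]
      exact Nat.succ_lt_succ (h.col_strict i j hy)
  · rintro ⟨hrow, hcol⟩
    refine ⟨fun i j h => if_neg h, fun i j h => ?_, fun i j h => ?_⟩
    · have h' := D.up_left_mem le_rfl j.le_succ h
      have := hrow (i + p.1) (j + p.2) (add_mem_translate.mpr h')
      rw [Nat.add_right_comm, hT h', hT h] at this
      exact Nat.le_of_succ_le_succ (this (add_mem_translate.mpr h))
    · have h' := D.up_left_mem i.le_succ le_rfl h
      have := hcol (i + p.1) (j + p.2) (add_mem_translate.mpr h')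
      rw [Nat.add_right_comm, hT h', hT h] at this
      exact Nat.lt_of_succ_lt_succ (this (add_mem_translate.mpr h))

end localFilling

section union

variable {A D nu : YoungDiagram} {p q : ℕ × ℕ} {T : ℕ → ℕ → ℕ}

theorem countEntry_union {S S' : Finset (ℕ × ℕ)} (h : Disjoint S S') (T : ℕ → ℕ → ℕ) (k : ℕ) :
    countEntry (S ∪ S') T k = countEntry S T k + countEntry S' T k := by
  rw [countEntry, Finset.filter_union,
    Finset.card_union_of_disjoint (Finset.disjoint_filter_filter h)]
  rfl

theorem readUpTo_union_of_mem_left {S S' : Finset (ℕ × ℕ)} {x : ℕ × ℕ}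
    (h : ∀ y ∈ S', x.1 < y.1) : readUpTo (S ∪ S') x = readUpTo S x := by
  rw [readUpTo, Finset.filter_union, Finset.filter_false_of_mem (s := S'), Finset.union_empty]
  · rfl
  · intro y hy
    have := h y hy
    omega

theorem readUpTo_union_of_mem_right {S S' : Finset (ℕ × ℕ)} {x : ℕ × ℕ}
    (h : ∀ y ∈ S, y.1 < x.1) : readUpTo (S ∪ S') x = S ∪ readUpTo S' x := by
  rw [readUpTo, Finset.filter_union, Finset.filter_true_of_mem (s := S)]
  · rfl
  · exact fun y hy => Or.inl (h y hy)

/-- A Littlewood-Richardson tableau on the union of a translate of `A` and of a translate of `D`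
further down consists of the superstandard filling of `A` and a dominant filling of `D`. -/
theorem isLRTableau_union_iff
    (h : ∀ x ∈ translate A p, ∀ y ∈ translate D q, x.1 < y.1 ∧ x.2 ≠ y.2) :
    IsLRTableau (translate A p ∪ translate D q) nu T ↔
      (∀ i j, (i, j) ∉ translate A p ∪ translate D q → T i j = 0) ∧
      (∀ x ∈ translate A p, 1 ≤ T x.1 x.2) ∧ (∀ x ∈ translate D q, 1 ≤ T x.1 x.2) ∧
      localFilling A p T = superstandard A ∧ IsDominant A D (localFilling D q T) ∧
      HasShape A D (localFilling D q T) nu := by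
  have hdisj : Disjoint (translate A p) (translate D q) :=
    Finset.disjoint_left.mpr fun x hx hx' => (h x hx x hx').1.false
  have hcontent (hA : ∀ x ∈ translate A p, 1 ≤ T x.1 x.2) (hD : ∀ x ∈ translate D q, 1 ≤ T x.1 x.2)
      (hsup : localFilling A p T = superstandard A) (k : ℕ) :
      countEntry (translate A p ∪ translate D q) T (k + 1) =
        partialShape A D (localFilling D q T) (D.colLen 0) k := by
    rw [countEntry_union hdisj, countEntry_translate hA, countEntry_translate hD, partialShape,
      hsup, ← partialShape_superstandard A k, partialShape, rowLen_bot, zero_add]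
  have hleft (hA : ∀ x ∈ translate A p, 1 ≤ T x.1 x.2) {r j : ℕ} (hrj : (r, j) ∈ A) (k : ℕ) :
      countEntry (readUpTo (translate A p ∪ translate D q) (r + p.1, j + p.2)) T (k + 1) =
        prefixCount A (localFilling A p T) r j k := by
    rw [readUpTo_union_of_mem_left fun y hy => (h _ (add_mem_translate.mpr hrj) y hy).1,
      countEntry_readUpTo_translate hA]
  have hright (hA : ∀ x ∈ translate A p, 1 ≤ T x.1 x.2) (hD : ∀ x ∈ translate D q, 1 ≤ T x.1 x.2)
      (hsup : localFilling A p T = superstandard A) {r j : ℕ} (hrj : (r, j) ∈ D) (k : ℕ) :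
      countEntry (readUpTo (translate A p ∪ translate D q) (r + q.1, j + q.2)) T (k + 1) =
        A.rowLen k + prefixCount D (localFilling D q T) r j k := by
    rw [readUpTo_union_of_mem_right fun y hy => (h y hy _ (add_mem_translate.mpr hrj)).1,
      countEntry_union (S' := readUpTo _ _) (hdisj.mono_right (Finset.filter_subset _ _)), countEntry_translate hA,
      countEntry_readUpTo_translate hD, hsup, ← partialShape_superstandard A k, partialShape,
      rowLen_bot, zero_add]
  constructor
  · intro hT
    have hA : ∀ x ∈ translate A p, 1 ≤ T x.1 x.2 := fun x hx =>
      hT.pos x.1 x.2 (Finset.mem_union_left _ hx)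
    have hD : ∀ x ∈ translate D q, 1 ≤ T x.1 x.2 := fun x hx =>
      hT.pos x.1 x.2 (Finset.mem_union_right _ hx)
    have hsA : IsSemistandard A (localFilling A p T) := (isSemistandard_localFilling_iff hA).mpr
      ⟨fun i j h1 h2 => hT.row_weak i j (Finset.mem_union_left _ h1) (Finset.mem_union_left _ h2),
        fun i j h1 h2 =>
          hT.col_strict i j (Finset.mem_union_left _ h1) (Finset.mem_union_left _ h2)⟩
    have hsD : IsSemistandard D (localFilling D q T) := (isSemistandard_localFilling_iff hD).mpr
      ⟨fun i j h1 h2 => hT.row_weak i j (Finset.mem_union_right _ h1) (Finset.mem_union_right _ h2),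
        fun i j h1 h2 =>
          hT.col_strict i j (Finset.mem_union_right _ h1) (Finset.mem_union_right _ h2)⟩
    -- Prefixes ending in `A` contain no box of `D`, so their lattice condition is dominance over
    -- the empty diagram.
    have hsup : localFilling A p T = superstandard A := by
      rw [← isDominant_bot_left_iff, isDominant_iff_lattice hsA]
      intro r j hrj k
      rw [rowLen_bot, rowLen_bot, zero_add, zero_add]
      have := hT.lattice _ (Finset.mem_union_left _ (add_mem_translate.mpr hrj)) (k + 1)
        (Nat.le_add_left _ _)
      rwa [hleft hA hrj, hleft hA hrj] at this
    refine ⟨hT.outside, hA, hD, hsup, (isDominant_iff_lattice hsD).mpr fun r j hrj k => ?_,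
      fun k => ?_⟩
    · have := hT.lattice _ (Finset.mem_union_right _ (add_mem_translate.mpr hrj)) (k + 1)
        (Nat.le_add_left _ _)
      rwa [hright hA hD hsup hrj, hright hA hD hsup hrj] at this
    · rw [← hT.content, hcontent hA hD hsup]
  · rintro ⟨hout, hA, hD, hsup, hdom, hshape⟩
    have hdomA := isDominant_bot_left_iff.mpr hsup
    obtain ⟨hrowA, hcolA⟩ := (isSemistandard_localFilling_iff hA).mp hdomA.toIsSemistandard
    obtain ⟨hrowD, hcolD⟩ := (isSemistandard_localFilling_iff hD).mp hdom.toIsSemistandard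
    refine ⟨hout, fun i j hij => ?_, fun i j h1 h2 => ?_, fun i j h1 h2 => ?_, fun k => ?_, ?_⟩
    · exact (Finset.mem_union.mp hij).elim (hA _) (hD _)
    · rcases Finset.mem_union.mp h1 with h1 | h1 <;> rcases Finset.mem_union.mp h2 with h2 | h2
      · exact hrowA i j h1 h2
      · exact absurd (h _ h1 _ h2).1 (lt_irrefl i)
      · exact absurd (h _ h2 _ h1).1 (lt_irrefl i)
      · exact hrowD i j h1 h2
    · rcases Finset.mem_union.mp h1 with h1 | h1 <;> rcases Finset.mem_union.mp h2 with h2 | h2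
      · exact hcolA i j h1 h2
      · exact absurd rfl (h _ h1 _ h2).2
      · exact absurd rfl (h _ h2 _ h1).2
      · exact hcolD i j h1 h2
    · rw [hcontent hA hD hsup, hshape]
    · intro c hc k hk
      obtain ⟨k, rfl⟩ : ∃ m, k = m + 1 := ⟨k - 1, (Nat.sub_add_cancel hk).symm⟩
      rcases Finset.mem_union.mp hc with hc | hc
      · obtain ⟨r, j, hrj, rfl⟩ := mem_translate.mp hc
        have := (isDominant_iff_lattice hdomA.toIsSemistandard).mp hdomA r j hrj k
        rwa [rowLen_bot, rowLen_bot, zero_add, zero_add, ← hleft hA hrj, ← hleft hA hrj] at this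
      · obtain ⟨r, j, hrj, rfl⟩ := mem_translate.mp hc
        rw [hright hA hD hsup hrj, hright hA hD hsup hrj]
        exact (isDominant_iff_lattice hdom.toIsSemistandard).mp hdom r j hrj k

/-- The Littlewood-Richardson tableaux on the union of a translate of `A` and of a translate of `D`
further down correspond to the dominant fillings of `D`. -/
theorem bijOn_localFilling
    (h : ∀ x ∈ translate A p, ∀ y ∈ translate D q, x.1 < y.1 ∧ x.2 ≠ y.2) (nu : YoungDiagram) :
    Set.BijOn (localFilling D q) {T | IsLRTableau (translate A p ∪ translate D q) nu T}
      {U | IsDominant A D U ∧ HasShape A D U nu} := by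
  refine ⟨fun T hT => ((isLRTableau_union_iff h).mp hT).2.2.2.2, ?_, ?_⟩
  · intro T hT T' hT' heq
    obtain ⟨hout, hA, hD, hsup, -⟩ := (isLRTableau_union_iff h).mp hT
    obtain ⟨hout', hA', hD', hsup', -⟩ := (isLRTableau_union_iff h).mp hT'
    funext x y
    by_cases hxy : (x, y) ∈ translate A p ∪ translate D q
    · rcases Finset.mem_union.mp hxy with hxy | hxy
      · obtain ⟨i, j, hij, heq'⟩ := mem_translate.mp hxy
        obtain ⟨rfl, rfl⟩ := Prod.mk.inj heq'
        rw [apply_add_eq_localFilling_add_one hA hij, apply_add_eq_localFilling_add_one hA' hij,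
          hsup, hsup']
      · obtain ⟨i, j, hij, heq'⟩ := mem_translate.mp hxy
        obtain ⟨rfl, rfl⟩ := Prod.mk.inj heq'
        rw [apply_add_eq_localFilling_add_one hD hij, apply_add_eq_localFilling_add_one hD' hij,
          heq]
    · rw [hout x y hxy, hout' x y hxy]
  · rintro U ⟨hU, hshape⟩
    let T : ℕ → ℕ → ℕ := fun x y =>
      if (x, y) ∈ translate A p then x - p.1 + 1
      else if (x, y) ∈ translate D q then U (x - q.1) (y - q.2) + 1 else 0
    have hTA : ∀ x y, (x, y) ∈ translate A p → T x y = x - p.1 + 1 := fun x y hxy => if_pos hxy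
    have hTD : ∀ x y, (x, y) ∈ translate D q → T x y = U (x - q.1) (y - q.2) + 1 :=
      fun x y hxy => by
        have : (x, y) ∉ translate A p := fun hxy' => (h _ hxy' _ hxy).1.false
        simp only [T, if_neg this, if_pos hxy]
    have hsup : localFilling A p T = superstandard A := by
      funext i j
      rw [localFilling, superstandard]
      split_ifs with hij
      · rw [hTA _ _ (add_mem_translate.mpr hij), Nat.add_sub_cancel, Nat.add_sub_cancel]
      · rfl
    have hloc : localFilling D q T = U := by
      funext i j
      rw [localFilling]
      split_ifs with hij
      · rw [hTD _ _ (add_mem_translate.mpr hij), Nat.add_sub_cancel, Nat.add_sub_cancel,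
          Nat.add_sub_cancel]
      · exact (hU.outside i j hij).symm
    refine ⟨T, (isLRTableau_union_iff h).mpr ⟨fun i j hij => ?_, fun x hx => ?_, fun x hx => ?_,
      hsup, hloc.symm ▸ hU, hloc.symm ▸ hshape⟩, hloc⟩
    · rw [Finset.mem_union, not_or] at hij
      simp only [T, if_neg hij.1, if_neg hij.2]
    · rw [hTA _ _ hx]
      exact Nat.le_add_left _ _
    · rw [hTD _ _ hx]
      exact Nat.le_add_left _ _

end union

/-! ### Northwest ribbons -/

theorem nwRest_subset (S : Finset (ℕ × ℕ)) (n : ℕ) : nwRest S n ⊆ S := by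
  induction n with
  | zero => exact subset_rfl
  | succ n ih => exact Finset.sdiff_subset.trans ih

theorem nwFirst_union {S S' : Finset (ℕ × ℕ)}
    (h : ∀ x ∈ S, ∀ y ∈ S', x + (1, 1) ≠ y ∧ y + (1, 1) ≠ x) :
    nwFirst (S ∪ S') = nwFirst S ∪ nwFirst S' := by
  ext c
  simp only [nwFirst, Finset.mem_filter, Finset.mem_union, or_imp, forall_and]
  constructor
  · rintro ⟨hc | hc, h1, h2⟩
    · exact Or.inl ⟨hc, h1⟩
    · exact Or.inr ⟨hc, h2⟩
  · rintro (⟨hc, h1⟩ | ⟨hc, h1⟩)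
    · exact ⟨Or.inl hc, h1, fun y hy => (h c hc y hy).2⟩
    · exact ⟨Or.inr hc, fun x hx => (h x hx c hc).1, h1⟩

theorem nwRest_union {S S' : Finset (ℕ × ℕ)} (hdisj : Disjoint S S')
    (h : ∀ x ∈ S, ∀ y ∈ S', x + (1, 1) ≠ y ∧ y + (1, 1) ≠ x) (n : ℕ) :
    nwRest (S ∪ S') n = nwRest S n ∪ nwRest S' n := by
  induction n with
  | zero => rfl
  | succ n ih =>
    rw [nwRest, ih, nwFirst_union fun x hx y hy =>
      h x (nwRest_subset S n hx) y (nwRest_subset S' n hy)]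
    ext c
    have h1 : c ∈ nwFirst (nwRest S n) → c ∈ nwRest S n := fun hc => Finset.filter_subset _ _ hc
    have h2 : c ∈ nwFirst (nwRest S' n) → c ∈ nwRest S' n := fun hc => Finset.filter_subset _ _ hc
    have h3 : c ∈ nwRest S n → c ∉ nwRest S' n := fun hc hc' =>
      Finset.disjoint_left.mp hdisj (nwRest_subset S n hc) (nwRest_subset S' n hc')
    simp only [nwRest, Finset.mem_sdiff, Finset.mem_union]
    tauto

theorem piNW_union {S S' : Finset (ℕ × ℕ)} (hdisj : Disjoint S S')
    (h : ∀ x ∈ S, ∀ y ∈ S', x + (1, 1) ≠ y ∧ y + (1, 1) ≠ x) :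
    piNW (S ∪ S') = piNW S + piNW S' := by
  funext n
  rw [Pi.add_apply, piNW, nwRibbon, nwRest_union hdisj h, nwFirst_union fun x hx y hy =>
    h x (nwRest_subset S n hx) y (nwRest_subset S' n hy), Finset.card_union_of_disjoint]
  · rfl
  · exact hdisj.mono ((Finset.filter_subset _ _).trans (nwRest_subset S n))
      ((Finset.filter_subset _ _).trans (nwRest_subset S' n))

/-- After `n` removals the boxes with both coordinates at least `n` remain; the northwest neighbour
is missing exactly when a coordinate equals `n`. -/
theorem nwFirst_map_filter (D : YoungDiagram) (p : ℕ × ℕ) (n : ℕ) :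
    nwFirst ((D.cells.filter fun c => n ≤ c.1 ∧ n ≤ c.2).map (addRightEmbedding p)) =
      (D.cells.filter fun c => (n ≤ c.1 ∧ n ≤ c.2) ∧ (c.1 = n ∨ c.2 = n)).map
        (addRightEmbedding p) := by
  rw [nwFirst, Finset.filter_map, Finset.filter_filter]
  refine congrArg _ (Finset.filter_congr fun c hc => and_congr_right fun hn => ?_)
  simp only [Function.comp_apply, Finset.forall_mem_map, addRightEmbedding_apply,
    Finset.mem_filter, YoungDiagram.mem_cells, ne_eq, add_right_comm _ p, add_left_inj]
  obtain ⟨i, j⟩ := c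
  constructor
  · intro h
    by_contra hne
    refine h (i - 1, j - 1) ⟨D.up_left_mem (Nat.sub_le _ _) (Nat.sub_le _ _) hc, ?_⟩ ?_
    · dsimp only at hn hne ⊢
      omega
    · dsimp only at hn hne
      rw [Prod.mk_add_mk, Nat.sub_add_cancel (by omega), Nat.sub_add_cancel (by omega)]
  · rintro h ⟨x, y⟩ ⟨-, hx⟩ heq
    obtain ⟨h1, h2⟩ := Prod.mk.inj heq
    dsimp only at h hx h1 h2
    omega

theorem nwRest_translate (D : YoungDiagram) (p : ℕ × ℕ) (n : ℕ) :
    nwRest (translate D p) n =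
      (D.cells.filter fun c => n ≤ c.1 ∧ n ≤ c.2).map (addRightEmbedding p) := by
  induction n with
  | zero => simp [nwRest, translate]
  | succ n ih =>
    rw [nwRest, ih, nwFirst_map_filter, ← Finset.map_sdiff]
    congr 1
    ext c
    simp only [Finset.mem_sdiff, Finset.mem_filter]
    by_cases hc : c ∈ D.cells
    · simp only [hc, true_and]
      omega
    · simp only [hc, false_and, not_false_eq_true, and_true]

/-- The `n`-th ribbon is the hook of `(n, n)`: its arm with the corner, and its leg. If `(n, n)` is
not in `D`, both intervals are empty. -/
theorem piNW_translate (D : YoungDiagram) (p : ℕ × ℕ) : piNW (translate D p) = hl D := by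
  funext n
  rw [piNW, nwRibbon, nwRest_translate, nwFirst_map_filter, Finset.card_map]
  have hset : (D.cells.filter fun c => (n ≤ c.1 ∧ n ≤ c.2) ∧ (c.1 = n ∨ c.2 = n)) =
      (Finset.Ico n (D.rowLen n)).image (fun j => (n, j)) ∪
        (Finset.Ico (n + 1) (D.colLen n)).image (fun i => (i, n)) := by
    ext ⟨i, j⟩
    simp only [Finset.mem_filter, YoungDiagram.mem_cells, Finset.mem_union, Finset.mem_image,
      Finset.mem_Ico, Prod.mk.injEq]
    constructor
    · rintro ⟨hD, ⟨hi, hj⟩, heq⟩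
      by_cases hin : i = n
      · subst hin
        exact Or.inl ⟨j, ⟨hj, YoungDiagram.mem_iff_lt_rowLen.mp hD⟩, rfl, rfl⟩
      · obtain rfl := heq.resolve_left hin
        exact Or.inr ⟨i, ⟨by omega, YoungDiagram.mem_iff_lt_colLen.mp hD⟩, rfl, rfl⟩
    · rintro (⟨j, ⟨h1, h2⟩, rfl, rfl⟩ | ⟨i, ⟨h1, h2⟩, rfl, rfl⟩)
      · exact ⟨YoungDiagram.mem_iff_lt_rowLen.mpr h2, ⟨le_rfl, h1⟩, Or.inl rfl⟩
      · exact ⟨YoungDiagram.mem_iff_lt_colLen.mpr h2, ⟨by omega, le_rfl⟩, Or.inr rfl⟩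
  rw [hset, Finset.card_union_of_disjoint,
    Finset.card_image_of_injective _ (Prod.mk_right_injective n),
    Finset.card_image_of_injective _ (Prod.mk_left_injective n), Nat.card_Ico, Nat.card_Ico]
  · simp only [hl, hookLength, arm, leg]
    have h1 := YoungDiagram.mem_iff_lt_rowLen (μ := D) (i := n) (j := n)
    have h2 := YoungDiagram.mem_iff_lt_colLen (μ := D) (i := n) (j := n)
    split_ifs with h <;> simp only [h, true_iff, false_iff] at h1 h2 <;> omega
  · rw [Finset.disjoint_left]
    simp only [Finset.mem_image, Finset.mem_Ico]
    rintro _ ⟨j, -, rfl⟩ ⟨i, hi, heq⟩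
    have := (Prod.mk.inj heq).1
    omega

/-! ### Skew diagrams that decompose into two partitions -/

/-- A nonempty translate occupies consecutive rows from its top. If `A` reached a row of `D`, it
would also have a box in the top row of `D`. -/
theorem lt_of_rows_ne {A D : YoungDiagram} {p q : ℕ × ℕ}
    (h : ∀ x ∈ translate A p, ∀ y ∈ translate D q, x.1 ≠ y.1) (hpq : p.1 ≤ q.1) :
    ∀ x ∈ translate A p, ∀ y ∈ translate D q, x.1 < y.1 := by
  intro x hx y hy
  obtain ⟨i, j, hA, rfl⟩ := mem_translate.mp hx
  obtain ⟨i', j', hD, rfl⟩ := mem_translate.mp hy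
  by_contra hlt
  dsimp only at hlt
  have h1 : (q.1 - p.1, 0) ∈ A := A.up_left_mem (by omega) j.zero_le hA
  have h2 : (0, 0) ∈ D := D.up_left_mem i'.zero_le j'.zero_le hD
  have := h _ (add_mem_translate.mpr h1) _ (add_mem_translate.mpr h2)
  dsimp only at this
  omega

/-- In a skew diagram, two diagonal neighbours force the box right of the upper one, which shares a
row with one and a column with the other. This excludes ribbons interacting across the components.
-/
theorem add_one_ne_of_skewDiagram {lam mu : YoungDiagram} {S S' : Finset (ℕ × ℕ)}
    (hS : skewDiagram lam mu = S ∪ S') (h : ∀ x ∈ S, ∀ y ∈ S', x.1 ≠ y.1 ∧ x.2 ≠ y.2) :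
    ∀ x ∈ S, ∀ y ∈ S', x + (1, 1) ≠ y := by
  rintro ⟨i, j⟩ hx y hy rfl
  have h1 : (i, j) ∈ skewDiagram lam mu := hS ▸ Finset.mem_union_left _ hx
  have h2 : (i + 1, j + 1) ∈ skewDiagram lam mu := hS ▸ Finset.mem_union_right _ hy
  rw [skewDiagram, Finset.mem_sdiff] at h1 h2
  have h3 : (i, j + 1) ∈ skewDiagram lam mu := Finset.mem_sdiff.mpr
    ⟨lam.up_left_mem i.le_succ le_rfl h2.1, fun hmu => h1.2 (mu.up_left_mem le_rfl j.le_succ hmu)⟩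
  rw [hS, Finset.mem_union] at h3
  rcases h3 with h3 | h3
  · exact (h _ h3 _ hy).2 rfl
  · exact (h _ hx _ h3).1 rfl

theorem piNW_of_decomposition {lam mu A D : YoungDiagram} {p q : ℕ × ℕ}
    (hS : skewDiagram lam mu = translate A p ∪ translate D q)
    (h : ∀ x ∈ translate A p, ∀ y ∈ translate D q, x.1 ≠ y.1 ∧ x.2 ≠ y.2) :
    piNW (skewDiagram lam mu) = hl A + hl D := by
  rw [hS, piNW_union, piNW_translate, piNW_translate]
  · exact Finset.disjoint_left.mpr fun x hx hx' => (h x hx x hx').1 rfl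
  · refine fun x hx y hy => ⟨add_one_ne_of_skewDiagram hS h x hx y hy, ?_⟩
    exact add_one_ne_of_skewDiagram (hS.trans (Finset.union_comm _ _))
      (fun y hy x hx => ⟨(h x hx y hy).1.symm, (h x hx y hy).2.symm⟩) y hy x hx

theorem skewCharacter_of_decomposition {lam mu A D : YoungDiagram} {p q : ℕ × ℕ}
    (hS : skewDiagram lam mu = translate A p ∪ translate D q)
    (h : ∀ x ∈ translate A p, ∀ y ∈ translate D q, x.1 < y.1 ∧ x.2 ≠ y.2) :
    IsSkewHl lam mu (hl A + hl D) ∧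
      {nu : YoungDiagram | Appears lam mu nu ∧ hl nu = hl A + hl D}.ncard =
        2 ^ min (durfee A) (durfee D) ∧
      ∀ nu : YoungDiagram, Appears lam mu nu → hl nu = hl A + hl D → lrCoeff lam mu nu = 1 := by
  have hcoeff : ∀ nu, lrCoeff lam mu nu =
      {U | IsDominant A D U ∧ HasShape A D U nu}.ncard := fun nu => by
    rw [lrCoeff, hS, ← (bijOn_localFilling h nu).image_eq,
      (bijOn_localFilling h nu).injOn.ncard_image]
  have happ : ∀ nu, Appears lam mu nu ↔ ∃ U, IsDominant A D U ∧ HasShape A D U nu := fun nu => by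
    have hfin : {U | IsDominant A D U ∧ HasShape A D U nu}.Finite := by
      rw [← (bijOn_localFilling h nu).image_eq]
      exact (finite_isLRTableau _ nu).image _
    rw [Appears, hcoeff]
    exact ⟨Set.nonempty_of_ncard_ne_zero, fun hU => (Set.ncard_pos hfin).mpr hU |>.ne'⟩
  have hcard : {nu : YoungDiagram | Appears lam mu nu ∧ hl nu = hl A + hl D}.ncard =
      2 ^ min (durfee A) (durfee D) := by
    simp only [happ]
    rw [Set.ncard, ← extremalShapes, encard_extremalShapes, ENat.toNat_natCast]
  refine ⟨⟨?_, ?_⟩, hcard, fun nu hnu heq => ?_⟩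
  -- The maximum is attained because the number of extremal shapes is a power of two, hence not
  -- zero.
  · obtain ⟨nu, hnu, heq⟩ := Set.nonempty_of_ncard_ne_zero (hcard.trans_ne (by positivity))
    exact ⟨nu, hnu, heq ▸ rfl⟩
  · rintro _ ⟨nu, hnu, rfl⟩
    obtain ⟨U, hU, hshape⟩ := (happ nu).mp hnu
    exact toLex_hl_le A D U nu hU hshape
  · obtain ⟨U, hU, hshape⟩ := (happ nu).mp hnu
    rw [hcoeff, Set.ncard_eq_one]
    refine ⟨U, Set.eq_singleton_iff_unique_mem.mpr ⟨⟨hU, hshape⟩, fun U' hU' => ?_⟩⟩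
    exact eq_of_hl_eq A D U' U nu hU'.1 hU hU'.2 hshape heq

end PrincipalHook

theorem theorem3p1 (lam mu alpha beta : YoungDiagram) (hmu : mu ≤ lam)
    (hdec : PrincipalHook.DecomposesInto (PrincipalHook.skewDiagram lam mu) alpha beta) :
    ∃ h : ℕ → ℕ, PrincipalHook.IsSkewHl lam mu h ∧
      h = PrincipalHook.hl alpha + PrincipalHook.hl beta ∧
      h = PrincipalHook.piNW (PrincipalHook.skewDiagram lam mu) ∧
      {nu : YoungDiagram | PrincipalHook.Appears lam mu nu ∧ PrincipalHook.hl nu = h}.ncard =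
        2 ^ min (PrincipalHook.durfee alpha) (PrincipalHook.durfee beta) ∧
      ∀ nu : YoungDiagram, PrincipalHook.Appears lam mu nu → PrincipalHook.hl nu = h →
        PrincipalHook.lrCoeff lam mu nu = 1 := by
  obtain ⟨p, q, hS, h⟩ := hdec
  refine ⟨PrincipalHook.hl alpha + PrincipalHook.hl beta, ?_⟩
  have hpi := PrincipalHook.piNW_of_decomposition hS h
  rcases le_total p.1 q.1 with hpq | hpq
  · have hlt := PrincipalHook.lt_of_rows_ne (fun x hx y hy => (h x hx y hy).1) hpq
    obtain ⟨h1, h2, h3⟩ := PrincipalHook.skewCharacter_of_decomposition hS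
      fun x hx y hy => ⟨hlt x hx y hy, (h x hx y hy).2⟩
    exact ⟨h1, rfl, hpi.symm, h2, h3⟩
  -- Here `beta` is the upper component; the statement is symmetric in the two partitions.
  · have hlt := PrincipalHook.lt_of_rows_ne (fun y hy x hx => (h x hx y hy).1.symm) hpq
    obtain ⟨h1, h2, h3⟩ := PrincipalHook.skewCharacter_of_decomposition
      (hS.trans (Finset.union_comm _ _)) fun y hy x hx => ⟨hlt y hy x hx, (h x hx y hy).2.symm⟩
    rw [add_comm (PrincipalHook.hl alpha), min_comm]
    exact ⟨h1, rfl, by rw [hpi, add_comm], h2, h3⟩
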